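/- All graphs are finite and simple. A *Hoffman graph* $\mathfrak H$ is a graph with a distinguished independent set of *fat* vertices, none of which is isolated; the other vertices are *slim*. $N^f(x)$ denotes the set of fat neighbors of $x$, and $\mathfrak H$ is *fat* if $N^f(x)\neq\emptyset$ for every slim $x$. If the adjacency matrix is written $\begin{pmatrix}A^s&C\\C^T&O\end{pmatrix}$ with the slim vertices first, then $\lambda_{\min}(\mathfrak H)$ is the smallest eigenvalue of $B(\mathfrak H)=A^s-CC^T$. An induced Hoffman subgraph is an induced subgraph, with the inherited fat and slim vertices, that is a Hoffman graph. $\mathfrak H$ is *indecomposable* if there is no family $\mathfrak H^1,\dots,\mathfrak H^n$ ($n\ge2$) of non-empty induced Hoffman subgraphs that cover all vertices of $\mathfrak H$, have pairwise disjoint sets of slim vertices, each contain $N^f(x)$ for each of their slim vertices $x$, and are such that for slim $x\in\mathfrak H^i$, $y\in\mathfrak H^j$ with $i\ne j$ one has $|N^f(x)\cap N^f(y)|\le1$, with equality if and only if $x,y$ are adjacent. $\mathfrak K_{1,2}$ is the Hoffman graph consisting of one slim vertex joined to two fat vertices. The *special graph* $\mathcal S(\mathfrak H)$ is the edge-signed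 graph on the slim vertices in which distinct $u,v$ form a $(+)$-edge if they are adjacent in $\mathfrak H$ and $N^f(u)\cap N^f(v)=\emptyset$, and a $(-)$-edge if they are not adjacent in $\mathfrak H$ and $N^f(u)\cap N^f(v)\ne\emptyset$. $U(\mathcal S(\mathfrak H))$ is its underlying unsigned graph. A vertex of a graph is a *cut vertex* if its removal increases the number of connected components. A *block* of a graph is a maximal subgraph among the connected subgraphs that have no cut vertex of their own. The block graph of $G$ has the blocks of $G$ as vertices, two distinct blocks being adjacent if they share a vertex; a *block graph* is a graph isomorphic to the block graph of some graph. A block of $\mathcal S(\mathfrak H)$ is the edge-signed subgraph induced by a block of $U(\mathcal S(\mathfrak H))$. $\mathcal K^+_n$ is the complete graph on $n$ vertices with all edges $(+)$, $\mathcal K^-_2$ consists of two vertices joined by a $(-)$-edge, and $\mathcal T_1^*$ is the triangle on $\{v^*,v_1,v_2\}$ with $(+)$-edge $\{v_1,v_2\}$ and $(-)$-edges $\{v^*,v_1\},\{v^*,v_2\}$. **Theorem.** Let $\mathfrak H$ be a fat indecomposable Hoffman graph with a slim vertex $v^*$ that has (at least) two fat neighbors. Then $\lambda_{\min}(\mathfrak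 H)>-3$ if and only if all of the following hold: (i) $U(\mathcal S(\mathfrak H))$ is a claw-free block graph (it has no induced $K_{1,3}$); (ii) $\mathfrak H$ has exactly one induced Hoffman subgraph isomorphic to $\mathfrak K_{1,2}$; (iii) $v^*$ is not a cut vertex of $U(\mathcal S(\mathfrak H))$; (iv) the block $\mathcal B^*$ of $\mathcal S(\mathfrak H)$ containing $v^*$ is isomorphic to $\mathcal K^+_n$ for some $n\ge1$ (the case $n=1$ arising only if $\mathfrak H$ is $\mathfrak K_{1,2}$ itself), or to $\mathcal K^-_2$, or to $\mathcal T_1^*$ by an isomorphism fixing $v^*$; (v) every block of $\mathcal S(\mathfrak H)$ other than $\mathcal B^*$ is isomorphic to $\mathcal K^+_n$ for some $n\ge2$ or to $\mathcal K^-_2$. -/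

import Mathlib

/-! ### Blocks, cut vertices and block graphs -/

namespace SimpleGraph

universe u

/-- `v` is a cut vertex of `G`: `G - v` has more connected components than `G`
(used for finite graphs). -/
def IsCutVertex {V : Type u} (G : SimpleGraph V) (v : V) : Prop :=
  Nat.card G.ConnectedComponent < Nat.card (G.induce ({v}ᶜ : Set V)).ConnectedComponent

/-- A connected graph without cut vertices (`K₁` and `K₂` are included). -/
def IsTwoConnected {V : Type u} (G : SimpleGraph V) : Prop :=
  G.Connected ∧ ∀ v, ¬ G.IsCutVertex v

/-- A block of `G`: a maximal 2-connected subgraph. -/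
def IsBlock {V : Type u} (G : SimpleGraph V) (B : G.Subgraph) : Prop :=
  Maximal (fun K : G.Subgraph => K.coe.IsTwoConnected) B

/-- The block graph `𝔹(G)`: its vertices are the blocks of `G`, two distinct blocks being
adjacent iff they have a common vertex. -/
def blockGraph {V : Type u} (G : SimpleGraph V) : SimpleGraph {B : G.Subgraph // G.IsBlock B} where
  Adj B C := B ≠ C ∧ (B.1.verts ∩ C.1.verts).Nonempty
  symm := ⟨fun _ _ h => ⟨h.1.symm, by rw [Set.inter_comm]; exact h.2⟩⟩
  loopless := ⟨fun _ h => h.1 rfl⟩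

/-- `G` is a block graph: it is isomorphic to the block graph of some (finite) graph. -/
def IsBlockGraph {V : Type u} (G : SimpleGraph V) : Prop :=
  ∃ (W : Type u) (_ : Finite W) (G' : SimpleGraph W), Nonempty (G ≃g G'.blockGraph)

/-- `G` has no induced subgraph isomorphic to `K_{1,3}`. -/
def IsClawFree {V : Type u} (G : SimpleGraph V) : Prop :=
  ¬ (completeBipartiteGraph (Fin 1) (Fin 3)).IsIndContained G

end SimpleGraph

/-! ### Edge-signed graphs -/

/-- An edge-signed graph: disjoint sets of `(+)`-edges and of `(-)`-edges on a vertex set. -/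
structure EdgeSignedGraph (V : Type*) where
  pos : SimpleGraph V
  neg : SimpleGraph V
  disjoint : Disjoint pos neg

namespace EdgeSignedGraph

/-- The underlying graph `U(S)`, whose edges are the `(+)`-edges and the `(-)`-edges. -/
def underlying {V : Type*} (S : EdgeSignedGraph V) : SimpleGraph V := S.pos ⊔ S.neg

/-- The induced edge-signed subgraph on a set of vertices. -/
def induce {V : Type*} (S : EdgeSignedGraph V) (W : Set V) : EdgeSignedGraph W where
  pos := S.pos.induce W
  neg := S.neg.induce W
  disjoint := by
    have h := S.disjoint
    rw [SimpleGraph.disjoint_left] at h ⊢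
    exact fun x y hx => h x y hx

/-- Isomorphisms of edge-signed graphs. -/
structure Iso {V W : Type*} (S : EdgeSignedGraph V) (T : EdgeSignedGraph W) extends V ≃ W where
  pos_iff : ∀ x y, T.pos.Adj (toEquiv x) (toEquiv y) ↔ S.pos.Adj x y
  neg_iff : ∀ x y, T.neg.Adj (toEquiv x) (toEquiv y) ↔ S.neg.Adj x y

/-- The `(+)`-complete graph `K⁺_n`. -/
def posComplete (n : ℕ) : EdgeSignedGraph (Fin n) where
  pos := ⊤
  neg := ⊥
  disjoint := disjoint_bot_right

/-- The `(-)`-complete graph `K⁻_2`. -/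
def negK2 : EdgeSignedGraph (Fin 2) where
  pos := ⊥
  neg := ⊤
  disjoint := disjoint_bot_left

/-- The triangle `T₁*` with distinguished vertex `v* = 0`: the only `(+)`-edge is `{1, 2}`, the
`(-)`-edges are `{0, 1}` and `{0, 2}`. -/
def triangleOne : EdgeSignedGraph (Fin 3) where
  pos := SimpleGraph.fromEdgeSet {s(1, 2)}
  neg := SimpleGraph.fromEdgeSet {s(0, 1), s(0, 2)}
  disjoint := by
    rw [SimpleGraph.disjoint_left]
    simp only [SimpleGraph.fromEdgeSet_adj]
    decide

end EdgeSignedGraph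

/-! ### Hoffman graphs -/

/-- A Hoffman graph on the vertex set `V`: a graph with a distinguished coclique of fat vertices,
none of which is isolated. -/
structure HoffmanGraph (V : Type*) where
  graph : SimpleGraph V
  fat : Set V
  coclique : graph.IsIndepSet fat
  not_isolated : ∀ f ∈ fat, ∃ x, graph.Adj f x

namespace HoffmanGraph

/-- The slim vertices. -/
abbrev Slim {V : Type*} (H : HoffmanGraph V) : Type _ := {x : V // x ∉ H.fat}

/-- The set `N^f(x)` of fat neighbors of `x`. -/
def fatNbrs {V : Type*} (H : HoffmanGraph V) (x : V) : Set V := {f | f ∈ H.fat ∧ H.graph.Adj x f}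

/-- Every slim vertex has a fat neighbor. -/
def IsFat {V : Type*} (H : HoffmanGraph V) : Prop := ∀ x, x ∉ H.fat → (H.fatNbrs x).Nonempty

/-- Isomorphisms of Hoffman graphs. -/
structure Iso {V W : Type*} (H : HoffmanGraph V) (K : HoffmanGraph W) extends V ≃ W where
  fat_iff : ∀ x, toEquiv x ∈ K.fat ↔ x ∈ H.fat
  adj_iff : ∀ x y, K.graph.Adj (toEquiv x) (toEquiv y) ↔ H.graph.Adj x y

/-- The subgraph induced by `W` is a Hoffman graph, i.e. has no isolated fat vertex. -/
def IsHoffmanSubset {V : Type*} (H : HoffmanGraph V) (W : Set V) : Prop :=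
  ∀ f ∈ W, f ∈ H.fat → ∃ x ∈ W, H.graph.Adj f x

/-- The induced Hoffman subgraph with vertex set `W`. -/
def induce {V : Type*} (H : HoffmanGraph V) (W : Set V) (hW : H.IsHoffmanSubset W) :
    HoffmanGraph W where
  graph := H.graph.induce W
  fat := {x | (x : V) ∈ H.fat}
  coclique := fun _ hx _ hy hxy => H.coclique hx hy (fun h => hxy (Subtype.ext h))
  not_isolated := fun f hf =>
    let ⟨x, hx, h⟩ := hW f f.2 hf
    ⟨⟨x, hx⟩, h⟩

/-- The Hoffman graph `𝔎_{1,2}`: one slim vertex joined to two fat vertices. -/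
def K12 : HoffmanGraph (Fin 1 ⊕ Fin 2) where
  graph := completeBipartiteGraph (Fin 1) (Fin 2)
  fat := Set.range Sum.inr
  coclique := by
    rintro _ ⟨i, rfl⟩ _ ⟨j, rfl⟩ _
    simp
  not_isolated := by
    rintro _ ⟨i, rfl⟩
    exact ⟨Sum.inl 0, by simp⟩

/-- The induced Hoffman subgraphs with vertex sets `W i` form a decomposition of `H`. -/
structure IsDecomposition {V ι : Type*} (H : HoffmanGraph V) (W : ι → Set V) : Prop where
  isHoffmanSubset : ∀ i, H.IsHoffmanSubset (W i)
  nonempty : ∀ i, (W i).Nonempty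
  iUnion_eq : ⋃ i, W i = Set.univ
  slim_disjoint : ∀ i j, i ≠ j → ∀ x, x ∉ H.fat → x ∈ W i → x ∉ W j
  fatNbrs_subset : ∀ i, ∀ x ∈ W i, x ∉ H.fat → H.fatNbrs x ⊆ W i
  common_le : ∀ i j, i ≠ j → ∀ x ∈ W i, ∀ y ∈ W j, x ∉ H.fat → y ∉ H.fat →
    (H.fatNbrs x ∩ H.fatNbrs y).ncard ≤ 1
  common_eq_one_iff : ∀ i j, i ≠ j → ∀ x ∈ W i, ∀ y ∈ W j, x ∉ H.fat → y ∉ H.fat →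
    ((H.fatNbrs x ∩ H.fatNbrs y).ncard = 1 ↔ H.graph.Adj x y)

/-- `H` has a decomposition into at least two parts. -/
def IsDecomposable {V : Type*} (H : HoffmanGraph V) : Prop :=
  ∃ n : ℕ, 2 ≤ n ∧ ∃ W : Fin n → Set V, H.IsDecomposition W

/-- `H` is not decomposable. -/
def IsIndecomposable {V : Type*} (H : HoffmanGraph V) : Prop := ¬ H.IsDecomposable

open scoped Classical in
/-- The block `A^s` of the adjacency matrix: slim vertices against slim vertices. -/
noncomputable def slimMatrix {V : Type*} (H : HoffmanGraph V) : Matrix H.Slim H.Slim ℝ :=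
  Matrix.of fun x y => if H.graph.Adj x y then 1 else 0

open scoped Classical in
/-- The block `C` of the adjacency matrix: slim vertices against fat vertices. -/
noncomputable def slimFatMatrix {V : Type*} (H : HoffmanGraph V) : Matrix H.Slim H.fat ℝ :=
  Matrix.of fun x f => if H.graph.Adj x f then 1 else 0

open scoped Classical in
/-- The matrix `B = A^s - C Cᵀ`. -/
noncomputable def matrixB {V : Type*} [Fintype V] (H : HoffmanGraph V) :
    Matrix H.Slim H.Slim ℝ :=
  H.slimMatrix - H.slimFatMatrix * H.slimFatMatrix.transpose

open scoped Classical in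
/-- The smallest eigenvalue of the real symmetric matrix `B` (whose spectrum is finite, and
nonempty as soon as there is a slim vertex). -/
noncomputable def lambdaMin {V : Type*} [Fintype V] (H : HoffmanGraph V) : ℝ :=
  sInf (spectrum ℝ H.matrixB)

/-- The special graph of `H`. -/
def specialGraph {V : Type*} (H : HoffmanGraph V) : EdgeSignedGraph H.Slim where
  pos :=
    { Adj := fun u v => u ≠ v ∧ H.graph.Adj u v ∧ H.fatNbrs u ∩ H.fatNbrs v = ∅
      symm := ⟨fun _ _ h => ⟨h.1.symm, h.2.1.symm, by rw [Set.inter_comm]; exact h.2.2⟩⟩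
      loopless := ⟨fun _ h => h.1 rfl⟩ }
  neg :=
    { Adj := fun u v => u ≠ v ∧ ¬ H.graph.Adj u v ∧ H.fatNbrs u ∩ H.fatNbrs v ≠ ∅
      symm := ⟨fun _ _ h => ⟨h.1.symm, fun h' => h.2.1 h'.symm,
        by rw [Set.inter_comm]; exact h.2.2⟩⟩
      loopless := ⟨fun _ h => h.1 rfl⟩ }
  disjoint := by
    rw [SimpleGraph.disjoint_left]
    exact fun _ _ h h' => h'.2.1 h.2.1

end HoffmanGraph

/-!
The condition `λ_min(H) > -3` says that `M = B(H) + 3I` is positive definite. The diagonal entry of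
`M` at a slim vertex with `k` fat neighbours is `3 - k`, and its off-diagonal entries are the signs
of the edges of the special graph as soon as two slim vertices share at most one fat neighbour;
indecomposability then makes the special graph connected (`HoffmanGraph.connected_underlying`).

If `M` is positive definite, it is the Gram matrix of a basis of an integral lattice that consists
of vectors of norm at most two, the vector of `v` having norm one. Adding these vectors one at a
time along the connected graph, starting from `v`, Bessel's inequality shows that each new vector
has norm two and is `±e b` plus a unit vector orthogonal to everything before
(`exists_isRootedTree_of_posDef`). So there is a tree rooted at `v`, with parent function `p`,
such that the vector of `a ≠ v` is `e a ± e (p a)`. Two slim vertices are adjacent in the special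
graph if and only if they are parent and child or siblings (`familyGraph`). This graph is the line
graph, and also the block graph, of the tree extended by one edge at its root; hence it is claw-free
and a block graph, its blocks are among the stars consisting of a vertex and its children, and `v`
is not a cut vertex. Triangles have positive sign (`IsRootedTree.treeGram_triangle`). As every slim
vertex other than `v` has only one fat neighbour and `v` has two, this leaves only the listed
signed blocks.

Conversely, let the blocks be complete with triangles of positive sign. Claw-freeness bounds the
number of blocks through a vertex by two, and `v` lies in only one as it is not a cut vertex. The
neighbour of a vertex that is closest to `v` serves as its parent, which gives a rooted tree with
the special graph as family graph (`SimpleGraph.exists_eq_familyGraph`). Positivity of the triangles makes `M`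
equal to `Nᵀ N` for a matrix `N` that is unitriangular with respect to the depth
(`IsRootedTree.posDef_treeGram`).
-/

namespace SimpleGraph

/-! ### Blocks as vertex sets -/

/-- The subgraph of `G` induced by the vertex set `W` is connected and has no cut vertex.
Removing a vertex outside `W` changes nothing, so the second condition may quantify over all
vertices. -/
def IsTwoConnectedOn {V : Type*} (G : SimpleGraph V) (W : Set V) : Prop :=
  (G.induce W).Connected ∧ ∀ a, (G.induce (W \ {a})).Preconnected

theorem isCutVertex_iff {V : Type*} [Finite V] {G : SimpleGraph V} (hG : G.Connected) (v : V) :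
    G.IsCutVertex v ↔ ¬ (G.induce ({v}ᶜ : Set V)).Preconnected := by
  have h1 : Nat.card G.ConnectedComponent = 1 := by
    have := hG.nonempty
    have := hG.preconnected.subsingleton_connectedComponent
    rw [Nat.card_eq_one_iff_unique]
    exact ⟨this, inferInstance⟩
  rw [IsCutVertex, h1, Finite.one_lt_card_iff_nontrivial, ← not_subsingleton_iff_nontrivial]
  refine not_congr ⟨fun h x y => ?_, fun h => h.subsingleton_connectedComponent⟩
  exact ConnectedComponent.exact (Subsingleton.elim _ _)

theorem isTwoConnected_iff {V : Type*} [Finite V] {G : SimpleGraph V} :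
    G.IsTwoConnected ↔ G.Connected ∧ ∀ v, (G.induce ({v}ᶜ : Set V)).Preconnected := by
  refine and_congr_right fun h => forall_congr' fun v => ?_
  rw [isCutVertex_iff h, not_not]

theorem Subgraph.isTwoConnectedOn_verts {V : Type*} [Finite V] {G : SimpleGraph V}
    {K : G.Subgraph} (hK : K.coe.IsTwoConnected) : G.IsTwoConnectedOn K.verts := by
  rw [isTwoConnected_iff] at hK
  have hconn : (G.induce K.verts).Connected :=
    hK.1.map (H := G.induce K.verts) ⟨id, fun h => K.adj_sub h⟩ Function.surjective_id
  refine ⟨hconn, fun a => ?_⟩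
  by_cases ha : a ∈ K.verts
  · refine (hK.2 ⟨a, ha⟩).map (H := G.induce (K.verts \ {a}))
      ⟨fun x => ⟨x.1.1, x.1.2, fun h => x.2 (Subtype.ext h)⟩, fun h => K.adj_sub h⟩ ?_
    rintro ⟨x, hx, hxa⟩
    exact ⟨⟨⟨x, hx⟩, fun h => hxa (congrArg Subtype.val h)⟩, rfl⟩
  · rw [Set.sdiff_singleton_eq_self ha]
    exact hconn.preconnected

theorem IsTwoConnectedOn.isTwoConnected {V : Type*} [Finite V] {G : SimpleGraph V} {W : Set V}
    (hW : G.IsTwoConnectedOn W) : ((⊤ : G.Subgraph).induce W).coe.IsTwoConnected := by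
  rw [isTwoConnected_iff]
  refine ⟨hW.1.map (H := ((⊤ : G.Subgraph).induce W).coe)
    ⟨id, fun {x y} h => ⟨x.2, y.2, h⟩⟩ Function.surjective_id, fun a => ?_⟩
  refine (hW.2 a.1).map (H := ((⊤ : G.Subgraph).induce W).coe.induce ({a}ᶜ : Set _))
    ⟨fun x => ⟨⟨x.1, x.2.1⟩, fun h => x.2.2 (congrArg Subtype.val h)⟩,
      fun {x y} h => ⟨x.2.1, y.2.1, h⟩⟩ ?_
  rintro ⟨⟨x, hx⟩, hxa⟩
  exact ⟨⟨x, hx, fun h => hxa (Subtype.ext h)⟩, rfl⟩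

/-- Blocks are induced subgraphs, so they are determined by their vertex sets, which are the maximal
vertex sets inducing a 2-connected graph. -/
theorem isBlock_iff {V : Type*} [Finite V] {G : SimpleGraph V} (K : G.Subgraph) :
    G.IsBlock K ↔ K = (⊤ : G.Subgraph).induce K.verts ∧ Maximal G.IsTwoConnectedOn K.verts := by
  constructor
  · intro h
    have h2 := Subgraph.isTwoConnectedOn_verts h.prop
    refine ⟨le_antisymm ?_ ?_, h2, fun W hW hKW => ?_⟩
    · exact Subgraph.le_induce_top_verts
    · exact h.2 h2.isTwoConnected Subgraph.le_induce_top_verts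
    · have := h.2 hW.isTwoConnected
        (Subgraph.le_induce_top_verts.trans (Subgraph.induce_mono_right hKW))
      exact this.1
  · rintro ⟨h1, h2⟩
    refine ⟨by rw [h1]; exact h2.prop.isTwoConnected, fun L hL hKL => ?_⟩
    have h3 := h2.2 (Subgraph.isTwoConnectedOn_verts hL) hKL.1
    rw [h1]
    exact Subgraph.le_induce_top_verts.trans (Subgraph.induce_mono_right h3)

theorem isBlock_induce_iff {V : Type*} [Finite V] {G : SimpleGraph V} (W : Set V) :
    G.IsBlock ((⊤ : G.Subgraph).induce W) ↔ Maximal G.IsTwoConnectedOn W := by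
  rw [isBlock_iff]
  simp

/-- Every 2-connected vertex set lies in a block. -/
theorem IsTwoConnectedOn.exists_isBlock {V : Type*} [Finite V] {G : SimpleGraph V} {W : Set V}
    (hW : G.IsTwoConnectedOn W) : ∃ B : G.Subgraph, G.IsBlock B ∧ W ⊆ B.verts := by
  obtain ⟨X, hWX, hX⟩ := (Set.toFinite {X | G.IsTwoConnectedOn X}).exists_le_maximal hW
  exact ⟨(⊤ : G.Subgraph).induce X, (isBlock_induce_iff X).2 hX, hWX⟩

theorem IsClique.isTwoConnectedOn {V : Type*} {G : SimpleGraph V} {W : Set V}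
    (hW : G.IsClique W) (hne : W.Nonempty) : G.IsTwoConnectedOn W := by
  have key : ∀ X ⊆ W, (G.induce X).Preconnected := by
    rintro X hX ⟨x, hx⟩ ⟨y, hy⟩
    by_cases hxy : x = y
    · subst hxy; rfl
    · exact Adj.reachable (hW (hX hx) (hX hy) hxy)
  have := hne.to_subtype
  exact ⟨⟨key W subset_rfl⟩, fun a => key _ Set.sdiff_subset⟩

/-- A vertex together with a path joining two of its neighbours and avoiding it
induces a 2-connected graph: it carries a spanning cycle. -/
theorem isTwoConnectedOn_insert_support {V : Type*} {G : SimpleGraph V} {x y z : V}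
    (hxy : G.Adj x y) (hxz : G.Adj x z) (q : G.Walk y z) (hq : q.IsPath) (hx : x ∉ q.support) :
    G.IsTwoConnectedOn (insert x {u | u ∈ q.support}) := by
  classical
  set W : Set V := insert x {u | u ∈ q.support} with hW
  -- `X` is `W` with at most one vertex other than `x` removed.
  have key : ∀ X ⊆ W, x ∈ X → (∀ a ∈ W, ∀ b ∈ W, a ∉ X → b ∉ X → a = b) →
      (G.induce X).Preconnected := by
    intro X hXW hxX hX
    have hto : ∀ u (hu : u ∈ X), (G.induce X).Reachable ⟨x, hxX⟩ ⟨u, hu⟩ := by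
      intro u hu
      rcases hXW hu with rfl | huq
      · rfl
      by_cases h : ∀ a ∈ (q.takeUntil u huq).support, a ∈ X
      · have hy : y ∈ X := h _ (Walk.start_mem_support _)
        exact (Adj.reachable (G := G.induce X) (u := ⟨x, hxX⟩) (v := ⟨y, hy⟩) hxy).trans
          ((q.takeUntil u huq).induce X h).reachable
      · push Not at h
        obtain ⟨a, ha, haX⟩ := h
        have h' : ∀ b ∈ (q.dropUntil u huq).support, b ∈ X := by
          intro b hb
          by_contra hbX
          have hab : a = b := hX a (Or.inr (q.support_takeUntil_subset_support huq ha)) b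
            (Or.inr (q.support_dropUntil_subset_support huq hb)) haX hbX
          subst hab
          have hau : a ≠ u := fun h => haX (h ▸ hu)
          have hp := hq
          rw [← q.take_spec huq, Walk.isPath_def, Walk.support_append, List.nodup_append'] at hp
          rw [← Walk.cons_tail_support] at hb
          exact hp.2.2 ha ((List.mem_cons.1 hb).resolve_left hau)
        have hz : z ∈ X := h' _ (Walk.end_mem_support _)
        exact (Adj.reachable (G := G.induce X) (u := ⟨x, hxX⟩) (v := ⟨z, hz⟩) hxz).trans
          ((q.dropUntil u huq).induce X h').reachable.symm
    exact fun u w => (hto u.1 u.2).symm.trans (hto w.1 w.2)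
  have hxW : x ∈ W := Set.mem_insert _ _
  refine ⟨@Connected.mk _ _ (key W subset_rfl hxW fun a ha b _ h => absurd ha h) ⟨⟨x, hxW⟩⟩,
    fun a => ?_⟩
  by_cases hax : x = a
  · subst hax
    have hsub : W \ {x} = {u | u ∈ q.support} := by
      rw [hW, Set.insert_sdiff_of_mem _ (Set.mem_singleton x)]
      exact Set.sdiff_singleton_eq_self hx
    rw [hsub]
    exact q.connected_induce_support.preconnected
  · refine key _ Set.sdiff_subset ⟨hxW, hax⟩ fun b hb c hc hb' hc' => ?_
    have h1 : b = a := by by_contra h; exact hb' ⟨hb, h⟩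
    have h2 : c = a := by by_contra h; exact hc' ⟨hc, h⟩
    rw [h1, h2]

end SimpleGraph

/-! ### Positive definite forms and rooted trees -/

/-- `p` is the parent function of a tree on `S` with root `v`, and `d` is the depth in this tree.
The root is its own parent. -/
structure IsRootedTree {S : Type*} (v : S) (p : S → S) (d : S → ℕ) : Prop where
  parent_root : p v = v
  depth_root : d v = 0
  depth : ∀ a, a ≠ v → d a = d (p a) + 1

/-- The Gram matrix of the vectors `e a + s a • e (p a)`, where `e` is orthonormal. -/
def treeGram {S : Type*} [DecidableEq S] (p : S → S) (s : S → ℤ) (a b : S) : ℤ :=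
  (if a = b then 1 else 0) + (if a = p b then s b else 0) + (if p a = b then s a else 0) +
    (if p a = p b then s a * s b else 0)

open Submodule in
/-- A lattice vector `y` of norm at most two outside the span of an orthonormal system `e`, but not
orthogonal to it, is `±e b` plus a vector of norm one orthogonal to `e`: by Bessel's inequality,
which is strict outside the span, its integral coordinates have sum of squares less than two. -/
theorem exists_norm_one_of_norm_le_two {S E : Type*} [AddCommGroup E] (B : LinearMap.BilinForm ℤ E)
    (hsymm : ∀ f g, B f g = B g f) (hpos : ∀ f, f ≠ 0 → 0 < B f f) (e : S → E)
    (A : Finset S) [DecidableEq S] (he : ∀ b ∈ A, ∀ c ∈ A, B (e b) (e c) = if b = c then 1 else 0)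
    (y : E) (hy2 : B y y ≤ 2) (hy : y ∉ span ℤ (e '' A)) (hne : ∃ b ∈ A, B y (e b) ≠ 0) :
    ∃ b ∈ A, ∃ s : ℤ, s * s = 1 ∧ B (y - s • e b) (y - s • e b) = 1 ∧
      ∀ c ∈ A, B (y - s • e b) (e c) = 0 := by
  set w := y - ∑ b ∈ A, B y (e b) • e b with hw
  have hwe : ∀ c ∈ A, B w (e c) = 0 := by
    intro c hc
    rw [hw, map_sub, LinearMap.sub_apply, map_sum, LinearMap.sum_apply]
    simp only [map_smul, LinearMap.smul_apply, smul_eq_mul]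
    rw [Finset.sum_congr rfl fun b hb => by rw [he b hb c hc]]
    simp [hc]
  have hww : B w w = B y y - ∑ b ∈ A, B y (e b) * B y (e b) := by
    have h1 : B w w = B w y := by
      conv_lhs => rw [hw, map_sub, map_sum, ← hw]
      rw [Finset.sum_eq_zero, sub_zero]
      intro b hb
      rw [map_smul, hwe b hb, smul_zero]
    rw [h1, hw, map_sub, LinearMap.sub_apply, map_sum, LinearMap.sum_apply]
    simp only [map_smul, LinearMap.smul_apply, smul_eq_mul]
    congr 1
    exact Finset.sum_congr rfl fun b _ => by rw [hsymm (e b) y]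
  have hw0 : w ≠ 0 := by
    intro h
    apply hy
    rw [sub_eq_zero.1 h]
    exact sum_mem fun b hb => smul_mem _ _ (subset_span ⟨b, hb, rfl⟩)
  have hwpos := hpos w hw0
  obtain ⟨b, hb, hb0⟩ := hne
  have hsplit := Finset.add_sum_erase A (fun b => B y (e b) * B y (e b)) hb
  have hb1 : 0 < B y (e b) * B y (e b) := mul_self_pos.2 hb0
  have hrest : ∀ c ∈ A.erase b, 0 ≤ B y (e c) * B y (e c) := fun c _ => mul_self_nonneg _
  have hrest0 := Finset.sum_nonneg hrest
  have hsum0 : ∑ c ∈ A.erase b, B y (e c) * B y (e c) = 0 := by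
    linarith
  have hzero := (Finset.sum_eq_zero_iff_of_nonneg hrest).1 hsum0
  have hwb : w = y - B y (e b) • e b := by
    rw [hw, ← Finset.add_sum_erase A _ hb, Finset.sum_eq_zero, add_zero]
    intro c hc
    rw [mul_self_eq_zero.1 (hzero c hc), zero_smul]
  refine ⟨b, hb, B y (e b), ?_, ?_, ?_⟩
  · linarith
  · rw [← hwb]; linarith
  · rw [← hwb]; exact hwe

open Submodule in
/-- Linearly independent vectors of norm at most two in a positive definite integral lattice, one
of them of norm one, whose graph of non-orthogonality is connected, are obtained from an orthonormal
system `e` along a rooted tree: they are `e a ± e (p a)`, except for the root `e v`. -/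
theorem exists_isRootedTree_of_posDef {S E : Type*} [Finite S] [DecidableEq S] [AddCommGroup E]
    (B : LinearMap.BilinForm ℤ E) (hsymm : ∀ f g, B f g = B g f) (hpos : ∀ f, f ≠ 0 → 0 < B f f)
    (x : S → E) (hx : LinearIndependent ℤ x) (v : S) (hv : B (x v) (x v) = 1)
    (h2 : ∀ a, B (x a) (x a) ≤ 2)
    (hconn : ∀ A : Finset S, v ∈ A → (∃ a, a ∉ A) → ∃ a, a ∉ A ∧ ∃ b ∈ A, B (x a) (x b) ≠ 0) :
    ∃ (p : S → S) (d : S → ℕ) (s : S → ℤ), IsRootedTree v p d ∧ s v = 0 ∧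
      (∀ a, a ≠ v → s a * s a = 1) ∧ ∀ a b, B (x a) (x b) = treeGram p s a b := by
  -- The system is built one vector at a time; `A` is the part of the tree built so far.
  have main : ∀ n : ℕ, n < Nat.card S → ∃ A : Finset S, A.card = n + 1 ∧ v ∈ A ∧
      ∃ (e : S → E) (p : S → S) (d : S → ℕ) (s : S → ℤ), p v = v ∧ d v = 0 ∧ s v = 0 ∧
        (∀ b ∈ A, e b ∈ span ℤ (x '' A)) ∧
        (∀ b ∈ A, ∀ c ∈ A, B (e b) (e c) = if b = c then 1 else 0) ∧
        (∀ b ∈ A, p b ∈ A ∧ x b = e b + s b • e (p b)) ∧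
        (∀ b ∈ A, b ≠ v → s b * s b = 1 ∧ d b = d (p b) + 1) := by
    intro n
    induction n with
    | zero =>
      intro _
      refine ⟨{v}, rfl, by simp, x, fun _ => v, fun _ => 0, fun _ => 0, rfl, rfl, rfl, ?_, ?_, ?_,
        ?_⟩
      · intro b hb
        exact subset_span ⟨b, hb, rfl⟩
      · simp [hv]
      · simp
      · simp
    | succ n ih =>
      intro hn
      obtain ⟨A, hA, hvA, e, p, d, s, hp, hd, hs, hspan, he, hxe, htree⟩ := ih (by omega)
      obtain ⟨a, ha, b, hb, hab⟩ := hconn A hvA (by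
        by_contra! h
        have : Fintype S := Fintype.ofFinite S
        rw [Finset.eq_univ_iff_forall.2 h, Finset.card_univ, ← Nat.card_eq_fintype_card] at hA
        omega)
      have hspan' : span ℤ (e '' A) ≤ span ℤ (x '' A) :=
        span_le.2 (by rintro _ ⟨b, hb, rfl⟩; exact hspan b hb)
      have hy : x a ∉ span ℤ (e '' A) := fun h =>
        hx.notMem_span_image (s := (A : Set S)) (by simpa using ha) (hspan' h)
      obtain ⟨c, hc, t, ht, hw1, hw0⟩ := exists_norm_one_of_norm_le_two B hsymm hpos e A he (x a)
        (h2 a) hy (by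
          by_contra! h
          apply hab
          rw [(hxe b hb).2, map_add, map_smul, h b hb, h _ (hxe b hb).1]
          simp)
      have hne : ∀ b ∈ A, b ≠ a := fun b hb h => ha (h ▸ hb)
      have hva := hne v hvA
      have hmono : span ℤ (x '' A) ≤ span ℤ (x '' (insert a A : Finset S)) :=
        span_mono (Set.image_mono (by simp))
      refine ⟨insert a A, by rw [Finset.card_insert_of_notMem ha, hA], by simp [hvA],
        Function.update e a (x a - t • e c), Function.update p a c, Function.update d a (d c + 1),
        Function.update s a t, ?_, ?_, ?_, ?_, ?_, ?_, ?_⟩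
      · rw [Function.update_of_ne hva, hp]
      · rw [Function.update_of_ne hva, hd]
      · rw [Function.update_of_ne hva, hs]
      · intro b hb
        rcases Finset.mem_insert.1 hb with rfl | hb
        · rw [Function.update_self]
          exact sub_mem (subset_span ⟨b, by simp, rfl⟩) (smul_mem _ _ (hmono (hspan c hc)))
        · rw [Function.update_of_ne (hne b hb)]
          exact hmono (hspan b hb)
      · intro b hb b' hb'
        rcases Finset.mem_insert.1 hb with h | hb <;>
          rcases Finset.mem_insert.1 hb' with h' | hb'
        · simp only [h, h', Function.update_self, if_true, hw1]
        · rw [h, Function.update_self, Function.update_of_ne (hne b' hb'), hw0 b' hb',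
            if_neg (hne b' hb').symm]
        · rw [h', Function.update_self, Function.update_of_ne (hne b hb), hsymm, hw0 b hb,
            if_neg (hne b hb)]
        · rw [Function.update_of_ne (hne b hb), Function.update_of_ne (hne b' hb'), he b hb b' hb']
      · intro b hb
        rcases Finset.mem_insert.1 hb with rfl | hb
        · refine ⟨by simp [hc], ?_⟩
          rw [Function.update_self, Function.update_self, Function.update_self,
            Function.update_of_ne (hne c hc), sub_add_cancel]
        · rw [Function.update_of_ne (hne b hb), Function.update_of_ne (hne b hb),
            Function.update_of_ne (hne b hb), Function.update_of_ne (hne _ (hxe b hb).1)]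
          exact ⟨Finset.mem_insert_of_mem (hxe b hb).1, (hxe b hb).2⟩
      · intro b hb hbv
        rcases Finset.mem_insert.1 hb with rfl | hb
        · rw [Function.update_self, Function.update_self, Function.update_self,
            Function.update_of_ne (hne c hc)]
          exact ⟨ht, rfl⟩
        · rw [Function.update_of_ne (hne b hb), Function.update_of_ne (hne b hb),
            Function.update_of_ne (hne b hb), Function.update_of_ne (hne _ (hxe b hb).1)]
          exact htree b hb hbv
  have : Nonempty S := ⟨v⟩
  have hcard : 0 < Nat.card S := Nat.card_pos
  obtain ⟨A, hA, -, e, p, d, s, hp, hd, hs, -, he, hxe, htree⟩ := main (Nat.card S - 1) (by omega)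
  have hAu : ∀ a, a ∈ A := by
    have : Fintype S := Fintype.ofFinite S
    rw [Nat.sub_add_cancel hcard, Nat.card_eq_fintype_card] at hA
    exact Finset.eq_univ_iff_forall.1 (Finset.card_eq_iff_eq_univ A |>.1 hA)
  refine ⟨p, d, s, ⟨hp, hd, fun a ha => (htree a (hAu a) ha).2⟩, hs,
    fun a ha => (htree a (hAu a) ha).1, fun a b => ?_⟩
  rw [(hxe a (hAu a)).2, (hxe b (hAu b)).2]
  simp only [map_add, map_smul, LinearMap.add_apply, LinearMap.smul_apply, smul_eq_mul,
    he _ (hAu _) _ (hAu _), treeGram]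
  split_ifs <;> ring

namespace IsRootedTree

variable {S : Type*} {v : S} {p : S → S} {d : S → ℕ}

theorem parent_ne (h : IsRootedTree v p d) {a : S} (ha : a ≠ v) : p a ≠ a := by
  intro h1
  have := h.depth a ha
  rw [h1] at this
  omega

theorem parent_parent_ne (h : IsRootedTree v p d) {a : S} (ha : a ≠ v) : p (p a) ≠ a := by
  intro h1
  have h2 := h.depth a ha
  by_cases hp : p a = v
  · rw [hp, h.parent_root] at h1
    exact ha h1.symm
  · have h3 := h.depth _ hp
    rw [h1] at h3
    omega

theorem ne_root_of_parent_ne (h : IsRootedTree v p d) {a : S} (ha : p a ≠ a) : a ≠ v := by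
  rintro rfl
  exact ha h.parent_root

theorem treeGram_self [DecidableEq S] (h : IsRootedTree v p d) {s : S → ℤ} (hs : s v = 0)
    (hs1 : ∀ a, a ≠ v → s a * s a = 1) (a : S) : treeGram p s a a = if a = v then 1 else 2 := by
  unfold treeGram
  by_cases ha : a = v
  · subst ha
    simp [hs]
  · rw [if_pos rfl, if_pos rfl, if_neg (h.parent_ne ha), if_neg (h.parent_ne ha).symm, if_neg ha,
      hs1 a ha]
    rfl

theorem treeGram_comm [DecidableEq S] (p : S → S) (s : S → ℤ) (a b : S) :
    treeGram p s a b = treeGram p s b a := by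
  simp only [treeGram, eq_comm (a := a), eq_comm (a := p a), mul_comm (s a)]
  ring

theorem treeGram_parent [DecidableEq S] (h : IsRootedTree v p d) {s : S → ℤ} (hs : s v = 0)
    {a : S} (ha : a ≠ v) : treeGram p s (p a) a = s a := by
  have h3 : (if p (p a) = p a then s (p a) * s a else 0) = 0 := by
    split_ifs with h3
    · have : p a = v := by
        by_contra h4
        exact h.parent_ne h4 h3
      rw [this, hs, zero_mul]
    · rfl
  rw [treeGram, if_neg (h.parent_ne ha), if_pos rfl, if_neg (h.parent_parent_ne ha), h3]
  ring

/-- The vertex `y` of the tree together with its children. -/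
def _root_.treeStar {S : Type*} (p : S → S) (y : S) : Set S := {a | a = y ∨ p a = y}

theorem ne_root_of_mem_treeStar (h : IsRootedTree v p d) {a y : S} (ha : a ∈ treeStar p y)
    (hay : a ≠ y) : a ≠ v := by
  rintro rfl
  rcases ha with ha | ha
  · exact hay ha
  · exact hay (h.parent_root.symm.trans ha)

theorem treeGram_of_mem_treeStar [DecidableEq S] (h : IsRootedTree v p d) {s : S → ℤ}
    (hs : s v = 0) {a b y : S} (ha : a ∈ treeStar p y) (hb : b ∈ treeStar p y) (hab : a ≠ b) :
    treeGram p s a b = (if a = y then 1 else s a) * (if b = y then 1 else s b) := by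
  by_cases hay : a = y <;> by_cases hby : b = y
  · exact absurd (hay.trans hby.symm) hab
  · have hbv := h.ne_root_of_mem_treeStar hb hby
    have hpb := hb.resolve_left hby
    rw [if_pos hay, if_neg hby, hay, ← hpb, h.treeGram_parent hs hbv, one_mul]
  · have hav := h.ne_root_of_mem_treeStar ha hay
    have hpa := ha.resolve_left hay
    rw [if_neg hay, if_pos hby, hby, ← hpa, treeGram_comm, h.treeGram_parent hs hav, mul_one]
  · have hpa := ha.resolve_left hay
    have hpb := hb.resolve_left hby
    rw [treeGram, if_neg hab, if_neg (by rw [hpb]; exact hay),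
      if_neg (by rw [hpa]; exact Ne.symm hby), if_pos (hpa.trans hpb.symm), if_neg hay, if_neg hby]
    ring

end IsRootedTree

/-- Two vertices of a rooted tree are adjacent if one is the parent of the other or if they
have the same parent. This is the line graph of the tree with one edge from each vertex to
its parent, where the root gets an additional parent. -/
def familyGraph {S : Type*} (p : S → S) : SimpleGraph S where
  Adj a b := a ≠ b ∧ (p a = b ∨ p b = a ∨ p a = p b)
  symm := ⟨fun a b h => ⟨h.1.symm, by
    rcases h.2 with h | h | h
    · exact Or.inr (Or.inl h)
    · exact Or.inl h
    · exact Or.inr (Or.inr h.symm)⟩⟩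
  loopless := ⟨fun _ h => h.1 rfl⟩

theorem isClique_treeStar {S : Type*} (p : S → S) (y : S) :
    (familyGraph p).IsClique (treeStar p y) := by
  rintro a (rfl | ha) b (rfl | hb) hab
  · exact absurd rfl hab
  · exact ⟨hab, Or.inr (Or.inl hb)⟩
  · exact ⟨hab, Or.inl ha⟩
  · exact ⟨hab, Or.inr (Or.inr (ha.trans hb.symm))⟩

namespace IsRootedTree

variable {S : Type*} {v : S} {p : S → S} {d : S → ℕ}

theorem mem_treeStar_of_adj (h : IsRootedTree v p d) {a b : S} (hab : (familyGraph p).Adj a b)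
    (hd : d b ≤ d a) : b ∈ treeStar p (p a) := by
  rcases hab.2 with h1 | h1 | h1
  · exact Or.inl h1.symm
  · have hbv : b ≠ v := by
      rintro rfl
      exact hab.1 (h1.symm.trans h.parent_root)
    have := h.depth b hbv
    rw [h1] at this
    omega
  · exact Or.inr h1.symm

theorem familyGraph_adj_iff_treeGram_ne_zero [DecidableEq S] (h : IsRootedTree v p d) {s : S → ℤ}
    (hs : s v = 0) (hs1 : ∀ a, a ≠ v → s a * s a = 1) {a b : S} (hab : a ≠ b) :
    (familyGraph p).Adj a b ↔ treeGram p s a b ≠ 0 := by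
  constructor
  · intro hadj
    have key : ∀ y, a ∈ treeStar p y → b ∈ treeStar p y → treeGram p s a b ≠ 0 := by
      intro y ha hb
      rw [h.treeGram_of_mem_treeStar hs ha hb hab]
      have hne : ∀ c ∈ treeStar p y, (if c = y then 1 else s c) ≠ 0 := by
        intro c hc
        split_ifs with hcy
        · exact one_ne_zero
        · intro h0
          have := hs1 c (h.ne_root_of_mem_treeStar hc hcy)
          rw [h0] at this
          omega
      exact mul_ne_zero (hne a ha) (hne b hb)
    rcases hadj.2 with h1 | h1 | h1
    · exact key (p a) (Or.inr rfl) (Or.inl h1.symm)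
    · exact key (p b) (Or.inl h1.symm) (Or.inr rfl)
    · exact key (p a) (Or.inr rfl) (Or.inr h1.symm)
  · intro h0
    by_contra hadj
    apply h0
    have h1 : p a ≠ b := fun h1 => hadj ⟨hab, Or.inl h1⟩
    have h2 : p b ≠ a := fun h1 => hadj ⟨hab, Or.inr (Or.inl h1)⟩
    have h3 : p a ≠ p b := fun h1 => hadj ⟨hab, Or.inr (Or.inr h1)⟩
    rw [treeGram, if_neg hab, if_neg h2.symm, if_neg h1, if_neg h3]
    rfl

/-- Three pairwise adjacent vertices lie in a common star, in which the signs of the edges are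
products of signs of vertices. -/
theorem treeGram_triangle [DecidableEq S] (h : IsRootedTree v p d) {s : S → ℤ}
    (hs : s v = 0) (hs1 : ∀ a, a ≠ v → s a * s a = 1) {a b c : S}
    (hab : (familyGraph p).Adj a b) (hbc : (familyGraph p).Adj b c) (hac : (familyGraph p).Adj a c) :
    treeGram p s a b * treeGram p s b c * treeGram p s a c = 1 := by
  obtain ⟨y, ha, hb, hc⟩ : ∃ y, a ∈ treeStar p y ∧ b ∈ treeStar p y ∧ c ∈ treeStar p y := by
    by_cases h1 : d b ≤ d a ∧ d c ≤ d a
    · exact ⟨p a, Or.inr rfl, h.mem_treeStar_of_adj hab h1.1, h.mem_treeStar_of_adj hac h1.2⟩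
    by_cases h2 : d a ≤ d b ∧ d c ≤ d b
    · exact ⟨p b, h.mem_treeStar_of_adj hab.symm h2.1, Or.inr rfl, h.mem_treeStar_of_adj hbc h2.2⟩
    · exact ⟨p c, h.mem_treeStar_of_adj hac.symm (by omega),
        h.mem_treeStar_of_adj hbc.symm (by omega), Or.inr rfl⟩
  rw [h.treeGram_of_mem_treeStar hs ha hb hab.1, h.treeGram_of_mem_treeStar hs hb hc hbc.1,
    h.treeGram_of_mem_treeStar hs ha hc hac.1]
  have hsq : ∀ c ∈ treeStar p y, (if c = y then 1 else s c) * (if c = y then 1 else s c) = 1 := by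
    intro c hc
    split_ifs with hcy
    · rfl
    · exact hs1 c (h.ne_root_of_mem_treeStar hc hcy)
  have h1 := hsq a ha
  have h2 := hsq b hb
  have h3 := hsq c hc
  generalize (if a = y then 1 else s a) = x at *
  generalize (if b = y then 1 else s b) = z at *
  generalize (if c = y then 1 else s c) = w at *
  linear_combination (z * z * w * w) * h1 + (w * w) * h2 + h3

end IsRootedTree

/-! ### Claw-freeness and the block graph of a tree -/

namespace SimpleGraph

theorem isClawFree_iff {V : Type*} {G : SimpleGraph V} :
    G.IsClawFree ↔ ∀ x a b c, G.Adj x a → G.Adj x b → G.Adj x c → a ≠ b → b ≠ c → a ≠ c →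
      G.Adj a b ∨ G.Adj b c ∨ G.Adj a c := by
  constructor
  · intro h x a b c ha hb hc hab hbc hac
    by_contra! hn
    obtain ⟨h1, h2, h3⟩ := hn
    have h1' : ¬ G.Adj b a := fun h => h1 h.symm
    have h2' : ¬ G.Adj c b := fun h => h2 h.symm
    have h3' : ¬ G.Adj c a := fun h => h3 h.symm
    let f : Fin 1 ⊕ Fin 3 → V := Sum.elim (fun _ => x) ![a, b, c]
    refine h ⟨⟨⟨f, ?_⟩, ?_⟩⟩
    · rintro (i | i) (j | j) hij
      · exact congrArg _ (Subsingleton.elim i j)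
      · fin_cases j <;> simp [f] at hij <;> subst hij <;> simp at ha hb hc
      · fin_cases i <;> simp [f] at hij <;> subst hij <;> simp at ha hb hc
      · fin_cases i <;> fin_cases j <;> simp_all [f]
    · intro i j
      change G.Adj (f i) (f j) ↔ _
      rcases i with i | i <;> rcases j with j | j
      · simp [f]
      · fin_cases j <;> simp [f, ha, hb, hc]
      · fin_cases i <;> simp [f, ha.symm, hb.symm, hc.symm]
      · fin_cases i <;> fin_cases j <;> simp [f, h1, h2, h3, h1', h2', h3']
  · rintro h ⟨f⟩
    have hadj : ∀ i : Fin 3, G.Adj (f (Sum.inl 0)) (f (Sum.inr i)) := fun i =>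
      f.map_rel_iff.2 (by simp)
    have hne : ∀ i j : Fin 3, i ≠ j → f (Sum.inr i) ≠ f (Sum.inr j) := fun i j hij h =>
      hij (Sum.inr_injective (f.injective h))
    have hn : ∀ i j : Fin 3, ¬ G.Adj (f (Sum.inr i)) (f (Sum.inr j)) := fun i j h => by
      have := f.map_rel_iff.1 h
      simp at this
    rcases h _ _ _ _ (hadj 0) (hadj 1) (hadj 2) (hne _ _ (by decide)) (hne _ _ (by decide))
      (hne _ _ (by decide)) with h | h | h <;> exact hn _ _ h

theorem Reachable.of_forall_adj {V : Type*} {G : SimpleGraph V} {P : V → Prop}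
    (hP : ∀ a b, G.Adj a b → P a → P b) {a b : V} (h : G.Reachable a b) (ha : P a) : P b := by
  obtain ⟨w⟩ := h
  induction w with
  | nil => exact ha
  | cons hadj _ ih => exact ih (hP _ _ hadj ha)

end SimpleGraph

/-- The parent of `a` in a tree with one more vertex, the new root `none`, which is the parent of the
former root `v`. -/
def extendedParent {S : Type*} [DecidableEq S] (v : S) (p : S → S) (a : S) : Option S :=
  if a = v then none else some (p a)

/-- The tree on `Option S` whose edges join each `some a` to the extended parent of `a`.
Its line graph is `familyGraph p`. -/
def parentTree {S : Type*} [DecidableEq S] (v : S) (p : S → S) : SimpleGraph (Option S) :=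
  SimpleGraph.fromRel fun α β => ∃ a, α = some a ∧ β = extendedParent v p a

namespace IsRootedTree

open SimpleGraph

variable {S : Type*} {v : S} {p : S → S} {d : S → ℕ}

theorem isClawFree_familyGraph (p : S → S) : (familyGraph p).IsClawFree := by
  rw [isClawFree_iff]
  intro x a b c ha hb hc hab hbc hac
  have key : ∀ z, (familyGraph p).Adj x z → z ∈ treeStar p x ∨ z ∈ treeStar p (p x) := by
    rintro z ⟨-, h | h | h⟩
    · exact Or.inr (Or.inl h.symm)
    · exact Or.inl (Or.inr h)
    · exact Or.inr (Or.inr h.symm)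
  rcases key a ha with ha | ha <;> rcases key b hb with hb | hb <;> rcases key c hc with hc | hc
  all_goals first
    | exact Or.inl (isClique_treeStar p _ ha hb hab)
    | exact Or.inr (Or.inl (isClique_treeStar p _ hb hc hbc))
    | exact Or.inr (Or.inr (isClique_treeStar p _ ha hc hac))

theorem depth_eq_of_parent_ne_root (h : IsRootedTree v p d) {a y : S} (ha : p a = y) (hay : a ≠ y) :
    d a = d y + 1 := by
  rw [h.depth a (h.ne_root_of_parent_ne (by rw [ha]; exact hay.symm)), ha]

/-- A vertex of maximal depth in a 2-connected set `W` is separated by its parent from all vertices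
other than its siblings. -/
theorem exists_subset_treeStar [Finite S] (h : IsRootedTree v p d) {W : Set S}
    (hW : (familyGraph p).IsTwoConnectedOn W) : ∃ y, W ⊆ treeStar p y := by
  have hne : W.Nonempty := Set.nonempty_coe_sort.1 hW.1.nonempty
  obtain ⟨x, hx, hmax⟩ := Set.exists_max_image W d (Set.toFinite W) hne
  refine ⟨p x, fun a ha => ?_⟩
  by_cases hxp : x = p x
  · have hxv : x = v := by
      by_contra hxv
      exact h.parent_ne hxv hxp.symm
    have hda := hmax a ha
    rw [hxv, h.depth_root] at hda
    have hav : a = v := by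
      by_contra hav
      have := h.depth a hav
      omega
    left
    rw [← hxp, hxv, hav]
  · by_cases hay : a = p x
    · exact Or.inl hay
    right
    have hdx := h.depth_eq_of_parent_ne_root rfl hxp
    refine (hW.2 (p x) ⟨x, hx, hxp⟩ ⟨a, ha, hay⟩).of_forall_adj (P := fun u => p u.1 = p x) ?_ rfl
    rintro ⟨u, hu, hup⟩ ⟨w, hw, hwp⟩ ⟨huw, hadj⟩ (hpu : p u = p x)
    change p w = p x
    rcases hadj with hadj | hadj | hadj
    · exact absurd (hadj.symm.trans hpu) hwp
    · have h1 := h.depth_eq_of_parent_ne_root (a := w) (y := u) hadj fun h => huw h.symm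
      have h2 := h.depth_eq_of_parent_ne_root hpu hup
      have h3 := hmax w hw
      omega
    · exact hadj.symm.trans hpu

theorem exists_eq_treeStar [Finite S] (h : IsRootedTree v p d) {W : Set S}
    (hW : Maximal (familyGraph p).IsTwoConnectedOn W) : ∃ y, W = treeStar p y := by
  obtain ⟨y, hy⟩ := h.exists_subset_treeStar hW.prop
  exact ⟨y, hW.eq_of_subset ((isClique_treeStar p y).isTwoConnectedOn ⟨y, Or.inl rfl⟩) hy⟩

theorem maximal_treeStar_root [Finite S] (h : IsRootedTree v p d) :
    Maximal (familyGraph p).IsTwoConnectedOn (treeStar p v) := by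
  refine ⟨(isClique_treeStar p v).isTwoConnectedOn ⟨v, Or.inl rfl⟩, fun W hW hle => ?_⟩
  obtain ⟨y, hy⟩ := h.exists_subset_treeStar hW
  have hv : v ∈ treeStar p y := hy (hle (Or.inl rfl))
  have hvy : y = v := by
    rcases hv with hv | hv
    · exact hv.symm
    · rw [← hv, h.parent_root]
  rwa [hvy] at hy

theorem exists_child_of_maximal (h : IsRootedTree v p d) {y : S} (hy : y ≠ v)
    (hW : Maximal (familyGraph p).IsTwoConnectedOn (treeStar p y)) : ∃ a, a ≠ y ∧ p a = y := by
  by_contra! hn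
  have hsub : treeStar p y ⊆ treeStar p (p y) := by
    rintro a (rfl | ha)
    · exact Or.inr rfl
    · by_cases hay : a = y
      · rw [hay]; exact Or.inr rfl
      · exact absurd ha (hn a hay)
  have h1 : p y ∈ treeStar p y :=
    hW.2 ((isClique_treeStar p (p y)).isTwoConnectedOn ⟨p y, Or.inl rfl⟩) hsub (Or.inl rfl)
  rcases h1 with h1 | h1
  · exact h.parent_ne hy h1
  · exact h.parent_parent_ne hy h1

theorem not_isCutVertex_root [Finite S] (h : IsRootedTree v p d) (hconn : (familyGraph p).Connected) :
    ¬ (familyGraph p).IsCutVertex v := by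
  rw [isCutVertex_iff hconn, not_not]
  have key : ∀ n (a b : S) (ha : a ≠ v) (hb : b ≠ v), d a + d b = n →
      ((familyGraph p).induce ({v}ᶜ : Set S)).Reachable ⟨a, ha⟩ ⟨b, hb⟩ := by
    intro n
    induction n using Nat.strong_induction_on with
    | _ n ih =>
      intro a b ha hb hab
      have hup : ∀ a (ha : a ≠ v) (hpa : p a ≠ v),
          ((familyGraph p).induce ({v}ᶜ : Set S)).Reachable ⟨a, ha⟩ ⟨p a, hpa⟩ := fun a ha hpa =>
        Adj.reachable (G := (familyGraph p).induce ({v}ᶜ : Set S)) (u := ⟨a, ha⟩) (v := ⟨p a, hpa⟩)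
          ⟨(h.parent_ne ha).symm, Or.inl rfl⟩
      have hda := h.depth a ha
      have hdb := h.depth b hb
      by_cases hpa : p a = v
      · by_cases hpb : p b = v
        · by_cases hab : a = b
          · subst hab; rfl
          · exact Adj.reachable (G := (familyGraph p).induce ({v}ᶜ : Set S)) (u := ⟨a, ha⟩)
              (v := ⟨b, hb⟩) ⟨hab, Or.inr (Or.inr (hpa.trans hpb.symm))⟩
        · exact (ih _ (by omega) a (p b) ha hpb rfl).trans (hup b hb hpb).symm
      · exact (hup a ha hpa).trans (ih _ (by omega) (p a) b hpa hb rfl)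
  rintro ⟨a, ha⟩ ⟨b, hb⟩
  exact key _ a b ha hb rfl

/-- The edge of `parentTree v p` from `a` to its extended parent. -/
def _root_.parentEdge {S : Type*} [DecidableEq S] (v : S) (p : S → S) (a : S) : Set (Option S) :=
  {some a, extendedParent v p a}

/-- The depth in `parentTree v p`. -/
def _root_.extendedDepth {S : Type*} (d : S → ℕ) (α : Option S) : ℕ := α.elim 0 fun a => d a + 1

section

variable [DecidableEq S]

theorem extendedDepth_parent (h : IsRootedTree v p d) (a : S) :
    extendedDepth d (extendedParent v p a) = d a := by
  unfold extendedParent extendedDepth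
  split_ifs with ha
  · rw [ha, h.depth_root]; rfl
  · rw [h.depth a ha]; rfl

theorem extendedParent_ne (h : IsRootedTree v p d) (a : S) : extendedParent v p a ≠ some a := by
  intro h1
  have := h.extendedDepth_parent a
  rw [h1] at this
  exact absurd this (Nat.succ_ne_self _)

theorem parentEdge_subset_iff (h : IsRootedTree v p d) {a b : S} :
    parentEdge v p a ⊆ parentEdge v p b ↔ a = b := by
  refine ⟨fun hab => ?_, fun hab => hab ▸ subset_rfl⟩
  have h1 : some a ∈ parentEdge v p b := hab (Or.inl rfl)
  have h2 : extendedParent v p a ∈ parentEdge v p b := hab (Or.inr rfl)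
  rcases h1 with h1 | h1
  · exact Option.some_injective _ h1
  · exfalso
    have ha := h.extendedDepth_parent a
    have hb := h.extendedDepth_parent b
    rw [← (show some a = _ from h1)] at hb
    rcases h2 with h2 | h2
    · rw [h2] at ha
      simp only [extendedDepth, Option.elim] at ha hb
      omega
    · exact h.extendedParent_ne a (h2.trans h1.symm)

theorem isClique_parentEdge (a : S) :
    (parentTree v p).IsClique (parentEdge v p a) := by
  rintro α (rfl | rfl) β (rfl | rfl) hne
  · exact absurd rfl hne
  · exact ⟨hne, Or.inl ⟨a, rfl, rfl⟩⟩
  · exact ⟨hne, Or.inr ⟨a, rfl, rfl⟩⟩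
  · exact absurd rfl hne

theorem exists_subset_parentEdge [Finite S] (h : IsRootedTree v p d) {W : Set (Option S)}
    (hW : (parentTree v p).IsTwoConnectedOn W) : ∃ a, W ⊆ parentEdge v p a := by
  have hne : W.Nonempty := Set.nonempty_coe_sort.1 hW.1.nonempty
  obtain ⟨α, hα, hmax⟩ := Set.exists_max_image W (extendedDepth d) (Set.toFinite W) hne
  rcases α with _ | x
  · refine ⟨v, fun β hβ => ?_⟩
    have := hmax β hβ
    rcases β with _ | b
    · exact Or.inr (by simp [extendedParent])
    · simp [extendedDepth] at this
  · refine ⟨x, fun β hβ => ?_⟩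
    by_cases hβx : β = extendedParent v p x
    · exact Or.inr hβx
    left
    refine (hW.2 (extendedParent v p x) ⟨some x, hα, (h.extendedParent_ne x).symm⟩
      ⟨β, hβ, hβx⟩).of_forall_adj (P := fun u => u.1 = some x) ?_ rfl
    rintro ⟨u, hu, hup⟩ ⟨w, hw, hwp⟩ hadj (rfl : u = some x)
    change w = some x
    obtain ⟨-, ⟨a, ha, ha'⟩ | ⟨a, ha, ha'⟩⟩ :
      (parentTree v p).Adj (some x) w := hadj
    · rw [Option.some_injective _ ha] at hwp
      exact absurd ha' hwp
    · have h1 := h.extendedDepth_parent a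
      rw [← ha'] at h1
      have h2 := hmax w hw
      rw [ha] at h2
      simp only [extendedDepth, Option.elim] at h1 h2
      omega

theorem isBlock_parentTree_iff [Finite S] (h : IsRootedTree v p d)
    (K : (parentTree v p).Subgraph) : (parentTree v p).IsBlock K ↔
      ∃ a, K = (⊤ : (parentTree v p).Subgraph).induce (parentEdge v p a) := by
  have hedge : ∀ a, (parentTree v p).IsTwoConnectedOn (parentEdge v p a) := fun a =>
    (isClique_parentEdge a).isTwoConnectedOn ⟨some a, Or.inl rfl⟩
  constructor
  · intro hK
    obtain ⟨h1, h2⟩ := (isBlock_iff K).1 hK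
    obtain ⟨a, ha⟩ := h.exists_subset_parentEdge h2.prop
    refine ⟨a, ?_⟩
    rw [← h2.eq_of_subset (hedge a) ha]
    exact h1
  · rintro ⟨a, rfl⟩
    rw [isBlock_induce_iff]
    refine ⟨hedge a, fun W hW hle => ?_⟩
    obtain ⟨b, hb⟩ := h.exists_subset_parentEdge hW
    rw [h.parentEdge_subset_iff.1 (hle.trans hb)]
    exact hb

theorem parentEdge_inter_nonempty_iff (h : IsRootedTree v p d) {a b : S} (hab : a ≠ b) :
    (parentEdge v p a ∩ parentEdge v p b).Nonempty ↔ (familyGraph p).Adj a b := by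
  constructor
  · rintro ⟨α, rfl | ha, hb | hb⟩
    · exact absurd (Option.some_injective _ hb) hab
    · have hb : some a = extendedParent v p b := hb
      unfold extendedParent at hb
      split_ifs at hb with hbv
      exact ⟨hab, Or.inr (Or.inl (Option.some_injective _ hb).symm)⟩
    · have ha : α = extendedParent v p a := ha
      have hb : α = some b := hb
      rw [hb] at ha
      unfold extendedParent at ha
      split_ifs at ha with hav
      exact ⟨hab, Or.inl (Option.some_injective _ ha).symm⟩
    · have ha : α = extendedParent v p a := ha
      have hb : α = extendedParent v p b := hb
      rw [hb] at ha
      unfold extendedParent at ha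
      split_ifs at ha with hbv hav hav
      · exact absurd (hav.trans hbv.symm) hab
      · exact ⟨hab, Or.inr (Or.inr (Option.some_injective _ ha).symm)⟩
  · have key : ∀ a b, a ≠ b → p a = b → (parentEdge v p a ∩ parentEdge v p b).Nonempty := by
      intro a b hab hpa
      refine ⟨some b, Or.inr ?_, Or.inl rfl⟩
      have hav := h.ne_root_of_parent_ne (a := a) (by rw [hpa]; exact hab.symm)
      change some b = extendedParent v p a
      rw [extendedParent, if_neg hav, hpa]
    rintro ⟨-, hadj | hadj | hadj⟩
    · exact key a b hab hadj
    · rw [Set.inter_comm]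
      exact key b a hab.symm hadj
    · by_cases hav : a = v
      · rw [hav, h.parent_root] at hadj
        rw [Set.inter_comm]
        exact key b a hab.symm (by rw [hav, hadj])
      by_cases hbv : b = v
      · rw [hbv, h.parent_root] at hadj
        exact key a b hab (by rw [hbv, hadj])
      refine ⟨some (p a), Or.inr ?_, Or.inr ?_⟩
      · change some (p a) = extendedParent v p a
        rw [extendedParent, if_neg hav]
      · change some (p a) = extendedParent v p b
        rw [extendedParent, if_neg hbv, hadj]

theorem isBlockGraph_familyGraph [Finite S] (h : IsRootedTree v p d) :
    (familyGraph p).IsBlockGraph := by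
  refine ⟨Option S, inferInstance, parentTree v p, ⟨⟨Equiv.ofBijective (fun a =>
    ⟨(⊤ : (parentTree v p).Subgraph).induce (parentEdge v p a),
      (h.isBlock_parentTree_iff _).2 ⟨a, rfl⟩⟩) ⟨?_, ?_⟩, ?_⟩⟩⟩
  · intro a b hab
    have : parentEdge v p a = parentEdge v p b := congrArg (fun B => B.1.verts) hab
    exact h.parentEdge_subset_iff.1 this.le
  · rintro ⟨K, hK⟩
    obtain ⟨a, ha⟩ := (h.isBlock_parentTree_iff K).1 hK
    exact ⟨a, Subtype.ext ha.symm⟩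
  · intro a b
    simp only [blockGraph]
    constructor
    · rintro ⟨hne, hab⟩
      refine (h.parentEdge_inter_nonempty_iff ?_).1 hab
      rintro rfl
      exact hne rfl
    · intro hab
      refine ⟨fun heq => hab.1 ?_, (h.parentEdge_inter_nonempty_iff hab.1).2 hab⟩
      have : parentEdge v p a = parentEdge v p b := congrArg (fun B => B.1.verts) heq
      exact h.parentEdge_subset_iff.1 this.le

end

end IsRootedTree

/-! ### The rooted tree of a claw-free graph with complete blocks -/

namespace SimpleGraph

/-- A connected claw-free graph with complete blocks is the family graph of a rooted tree
with any prescribed root `v` that is not a cut vertex. The parent of a vertex is its neighbour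
closest to `v`, and the depth is the distance from `v`. -/
theorem exists_eq_familyGraph {S : Type*} [Finite S] {G : SimpleGraph S} (hconn : G.Connected)
    (hclaw : G.IsClawFree) (hblock : ∀ W, G.IsTwoConnectedOn W → G.IsClique W) {v : S}
    (hv : ¬ G.IsCutVertex v) :
    ∃ (p : S → S) (d : S → ℕ), IsRootedTree v p d ∧ G = familyGraph p := by
  classical
  rw [isCutVertex_iff hconn, not_not] at hv
  rw [isClawFree_iff] at hclaw
  have hsupp : ∀ (x : S) (a b : ({x}ᶜ : Set S)) (q : (G.induce ({x}ᶜ : Set S)).Walk a b),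
      x ∉ (q.map (Embedding.induce _).toHom).support := by
    intro x a b q
    rw [Walk.support_map, List.mem_map]
    rintro ⟨a, -, ha⟩
    exact a.2 ha
  have hcyc : ∀ x y z (hxy : G.Adj x y) (hxz : G.Adj x z), y ≠ z →
      (G.induce ({x}ᶜ : Set S)).Reachable ⟨y, show y ∈ ({x}ᶜ : Set S) from hxy.ne'⟩
        ⟨z, show z ∈ ({x}ᶜ : Set S) from hxz.ne'⟩ → G.Adj y z := by
    intro x y z hxy hxz hyz hr
    obtain ⟨q, hq⟩ := hr.exists_isPath
    have hf := (Embedding.induce (G := G) ({x}ᶜ : Set S)).injective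
    have hW := isTwoConnectedOn_insert_support hxy hxz (q.map (Embedding.induce _).toHom)
      (hq.map hf) (hsupp x _ _ q)
    exact hblock _ hW (Or.inr (Walk.start_mem_support _)) (Or.inr (Walk.end_mem_support _)) hyz
  have hex : ∀ x, x ≠ v → ∃ y, G.Adj x y ∧ G.dist v x = G.dist v y + 1 := by
    intro x hx
    obtain ⟨q, hq⟩ := hconn.exists_walk_length_eq_dist x v
    cases q with
    | nil => exact absurd rfl hx
    | @cons _ y _ hxy q =>
      refine ⟨y, hxy, ?_⟩
      rw [Walk.length_cons] at hq
      have h1 := dist_le q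
      have h2 := hconn.dist_triangle (u := x) (v := y) (w := v)
      have h3 : G.dist x y = 1 := dist_eq_one_iff_adj.2 hxy
      rw [dist_comm (u := v), dist_comm (u := v)]
      omega
  choose! p hp using hex
  set d := G.dist v with hd
  have hd0 : d v = 0 := dist_self
  have hroot : ∀ x, d x = 0 → x = v := fun x hx => ((hconn.dist_eq_zero_iff).1 hx).symm
  have hlip : ∀ x y, G.Adj x y → d x ≤ d y + 1 := by
    intro x y hxy
    have h2 := hconn.dist_triangle (u := v) (v := y) (w := x)
    have h3 : G.dist y x = 1 := dist_eq_one_iff_adj.2 hxy.symm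
    change G.dist v x ≤ G.dist v y + 1
    omega
  have hreach : ∀ n x y (hxy : y ≠ x) (hx : v ≠ x), d y = n → d y ≤ d x →
      (G.induce ({x}ᶜ : Set S)).Reachable ⟨y, hxy⟩ ⟨v, hx⟩ := by
    intro n
    induction n with
    | zero =>
      intro x y hxy hx hy _
      obtain rfl := hroot y hy
      rfl
    | succ n ih =>
      intro x y hxy hx hy hle
      have hyv : y ≠ v := by
        rintro rfl
        omega
      obtain ⟨h1, h2⟩ := hp y hyv
      have hpx : p y ≠ x := by
        intro h
        rw [h] at h2
        omega
      exact (Adj.reachable (G := G.induce ({x}ᶜ : Set S)) (u := ⟨y, hxy⟩) (v := ⟨p y, hpx⟩) h1).trans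
        (ih x (p y) hpx hx (by omega) (by omega))
  have hlow : ∀ x y, x ≠ v → G.Adj x y → d y ≤ d x → y ≠ p x → G.Adj y (p x) := by
    intro x y hx hxy hle hne
    have h1 := hp x hx
    exact hcyc x y (p x) hxy h1.1 hne ((hreach _ x y hxy.ne' hx.symm rfl hle).trans
      (hreach _ x (p x) h1.1.ne' hx.symm rfl (by omega)).symm)
  have hup : ∀ x y, G.Adj x y → d x = d y + 1 → y = p x := by
    intro x y hxy hxd
    have hx : x ≠ v := by
      rintro rfl
      omega
    by_contra hne
    have h1 := hp x hx
    have h2 := hlow x y hx hxy (by omega) hne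
    have hy : y ≠ v := by
      rintro rfl
      exact hne (hroot (p x) (by omega)).symm
    have h3 := hp y hy
    have hxpy : x ≠ p y := by
      intro h
      rw [← h] at h3
      omega
    -- `x` and `p y` are joined by a walk through `p x` and `v` that avoids `y`.
    have h4 := hcyc y x (p y) hxy.symm h3.1 hxpy
      ((Adj.reachable (G := G.induce ({y}ᶜ : Set S)) (u := ⟨x, hxy.ne⟩) (v := ⟨p x, h2.ne'⟩)
        h1.1).trans ((hreach _ y (p x) h2.ne' hy.symm rfl (by omega)).trans
          (hreach _ y (p y) h3.1.ne' hy.symm rfl (by omega)).symm))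
    have := hlip _ _ h4
    omega
  have hsib : ∀ x y, G.Adj x y → d x = d y → p x = p y := by
    intro x y hxy hxd
    have hx : x ≠ v := by
      rintro rfl
      exact hxy.ne (hroot y (by omega)).symm
    have h1 := hp x hx
    refine hup y (p x) (hlow x y hx hxy (by omega) ?_) (by omega)
    intro h
    rw [← h] at h1
    omega
  set P : S → S := fun x => if x = v then v else p x with hP
  have hPv : P v = v := if_pos rfl
  have hPne : ∀ x, x ≠ v → P x = p x := fun x hx => if_neg hx
  have hPadj : ∀ x y, x ≠ y → P x = y → G.Adj x y := by
    intro x y hxy h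
    have hx : x ≠ v := by
      rintro rfl
      exact hxy (hPv.symm.trans h)
    rw [hPne x hx] at h
    exact h ▸ (hp x hx).1
  have hPup : ∀ x y, G.Adj x y → d x = d y + 1 → P x = y := by
    intro x y hxy h
    rw [hPne x (by rintro rfl; omega)]
    exact (hup x y hxy h).symm
  refine ⟨P, d, ⟨hPv, hd0, fun a ha => by rw [hPne a ha]; exact (hp a ha).2⟩, ?_⟩
  ext x y
  constructor
  · intro hxy
    refine ⟨hxy.ne, ?_⟩
    have h1 := hlip _ _ hxy
    have h2 := hlip _ _ hxy.symm
    rcases Nat.lt_trichotomy (d x) (d y) with h | h | h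
    · exact Or.inr (Or.inl (hPup y x hxy.symm (by omega)))
    · refine Or.inr (Or.inr ?_)
      have hx : x ≠ v := by
        rintro rfl
        exact hxy.ne (hroot y (by omega)).symm
      have hy : y ≠ v := by
        rintro rfl
        exact hxy.ne (hroot x (by omega))
      rw [hPne x hx, hPne y hy]
      exact hsib x y hxy h
    · exact Or.inl (hPup x y hxy (by omega))
  · rintro ⟨hne, h | h | h⟩
    · exact hPadj x y hne h
    · exact (hPadj y x hne.symm h).symm
    · by_cases hx : x = v
      · rw [hx, hPv] at h
        exact (hPadj y x hne.symm (by rw [hx, h])).symm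
      by_cases hy : y = v
      · rw [hy, hPv] at h
        exact hPadj x y hne (by rw [hy, h])
      rw [hPne x hx, hPne y hy] at h
      have h1 := hp x hx
      have h2 := hp y hy
      rw [← h] at h2
      by_cases hw : p x = v
      · rw [hw] at h1 h2
        exact hcyc v x y h1.1.symm h2.1.symm hne (hv _ _)
      · have h3 := hp _ hw
        have hnx : ¬ G.Adj (p (p x)) x := fun h => by have := hlip _ _ h.symm; omega
        have hny : ¬ G.Adj (p (p x)) y := fun h => by have := hlip _ _ h.symm; omega
        rcases hclaw (p x) (p (p x)) x y h3.1 h1.1.symm h2.1.symm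
          (by intro h; rw [h] at h3; omega) hne (by intro h; rw [h] at h3; omega) with h | h | h
        · exact absurd h hnx
        · exact h
        · exact absurd h hny

end SimpleGraph

/-! ### Positive definite matrices and smallest eigenvalues -/

/-- The Gram matrix of a rooted tree is `Nᵀ N`, where `N` is unitriangular if the vertices are
ordered by their depth. -/
theorem IsRootedTree.posDef_treeGram {S : Type*} [Fintype S] [DecidableEq S] {v : S} {p : S → S}
    {d : S → ℕ} (h : IsRootedTree v p d) {s : S → ℤ} (hs : s v = 0) :
    (Matrix.of fun a b => (treeGram p s a b : ℝ)).PosDef := by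
  set N : Matrix S S ℝ :=
    Matrix.of fun y a => (if y = a then 1 else 0) + (if y = p a then (s a : ℝ) else 0) with hN
  have hgram : (Matrix.of fun a b => (treeGram p s a b : ℝ)) = N.conjTranspose * N := by
    ext a b
    simp only [hN, Matrix.mul_apply, Matrix.conjTranspose_apply, Matrix.of_apply, star_trivial,
      mul_add, add_mul, Finset.sum_add_distrib, ite_mul, mul_ite, one_mul, mul_one, zero_mul,
      mul_zero, Finset.sum_ite_eq', Finset.mem_univ, if_true, treeGram,
      Int.cast_add, Int.cast_ite, Int.cast_one, Int.cast_zero, Int.cast_mul]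
    simp only [eq_comm (a := b), eq_comm (a := p b)]
    ring_nf
  rw [hgram]
  refine Matrix.PosDef.conjTranspose_mul_self N ?_
  rw [← Matrix.coe_mulVecLin, ← LinearMap.ker_eq_bot, LinearMap.ker_eq_bot']
  intro f hf
  by_contra hne
  have hne' : {y | f y ≠ 0}.Nonempty := by
    by_contra hn
    apply hne
    ext y
    by_contra hy
    exact hn ⟨y, hy⟩
  obtain ⟨y, hy, hmax⟩ := Set.exists_max_image _ d (Set.toFinite {y | f y ≠ 0}) hne'
  have hy0 : (N.mulVec f) y = 0 := congrFun hf y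
  have hsum : (N.mulVec f) y = f y + ∑ a, (if y = p a then (s a : ℝ) else 0) * f a := by
    simp [hN, Matrix.mulVec, dotProduct, add_mul, Finset.sum_add_distrib]
  rw [hsum, Finset.sum_eq_zero, add_zero] at hy0
  · exact hy hy0
  · intro a _
    split_ifs with ha
    · by_cases hav : a = v
      · rw [hav, hs]; simp
      · have h1 := h.depth a hav
        rw [← ha] at h1
        have h2 : f a = 0 := by
          by_contra h2
          have := hmax a h2
          omega
        rw [h2, mul_zero]
    · rw [zero_mul]

theorem Matrix.IsHermitian.lt_sInf_spectrum_iff {n : Type*} [Fintype n] [DecidableEq n] [Nonempty n]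
    {A : Matrix n n ℝ} (hA : A.IsHermitian) (c : ℝ) :
    c < sInf (spectrum ℝ A) ↔ (A - algebraMap ℝ _ c).PosDef := by
  have hA' : (A - algebraMap ℝ _ c).IsHermitian := by
    refine hA.sub ?_
    rw [Matrix.algebraMap_eq_diagonal]
    exact Matrix.isHermitian_diagonal_of_self_adjoint _ (by ext; simp)
  have hspec : ∀ r, r ∈ spectrum ℝ (A - algebraMap ℝ _ c) ↔ r + c ∈ spectrum ℝ A := by
    intro r
    rw [spectrum.mem_iff, spectrum.mem_iff, map_add]
    rw [show algebraMap ℝ (Matrix n n ℝ) r - (A - algebraMap ℝ _ c) =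
      algebraMap ℝ _ r + algebraMap ℝ _ c - A by abel]
  have hfin : (spectrum ℝ A).Finite := by
    rw [hA.spectrum_real_eq_range_eigenvalues]
    exact Set.finite_range _
  have hne : (spectrum ℝ A).Nonempty := by
    rw [hA.spectrum_real_eq_range_eigenvalues]
    exact Set.range_nonempty _
  rw [hA'.posDef_iff_eigenvalues_pos, hfin.lt_csInf_iff hne]
  have h1 : (∀ i, 0 < hA'.eigenvalues i) ↔ ∀ r ∈ spectrum ℝ (A - algebraMap ℝ _ c), 0 < r := by
    rw [hA'.spectrum_real_eq_range_eigenvalues, Set.forall_mem_range]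
  rw [h1]
  constructor
  · intro h r hr
    have := h _ ((hspec r).1 hr)
    linarith
  · intro h r hr
    have := h (r - c) ((hspec _).2 (by rwa [sub_add_cancel]))
    linarith

theorem Matrix.PosDef.toBilin'_pos_of_int {n : Type*} [Fintype n] [DecidableEq n]
    {Z : Matrix n n ℤ} (hZ : (Z.map ((↑) : ℤ → ℝ)).PosDef) {f : n → ℤ} (hf : f ≠ 0) :
    0 < Matrix.toBilin' Z f f := by
  have hf' : (fun i => (f i : ℝ)) ≠ 0 := by
    intro h
    apply hf
    ext i
    exact Int.cast_eq_zero.1 (congrFun h i)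
  have h1 := hZ.dotProduct_mulVec_pos hf'
  rw [Matrix.toBilin'_apply']
  have h2 : ((f ⬝ᵥ Z.mulVec f : ℤ) : ℝ) =
      star (fun i => (f i : ℝ)) ⬝ᵥ (Z.map ((↑) : ℤ → ℝ)).mulVec (fun i => (f i : ℝ)) := by
    simp [dotProduct, Matrix.mulVec]
  rw [← h2] at h1
  exact_mod_cast h1

/-! ### Fat neighbours, indecomposability and the special graph -/

namespace HoffmanGraph

variable {V : Type*}

open scoped Classical in
/-- The integer matrix `B + 3I`. -/
noncomputable def shiftedMatrix (H : HoffmanGraph V) : Matrix H.Slim H.Slim ℤ :=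
  Matrix.of fun x y => (if x = y then 3 else 0) + (if H.graph.Adj x y then 1 else 0) -
    ((H.fatNbrs x ∩ H.fatNbrs y).ncard : ℤ)

theorem shiftedMatrix_self (H : HoffmanGraph V) (x : H.Slim) :
    H.shiftedMatrix x x = 3 - ((H.fatNbrs x).ncard : ℤ) := by
  simp [shiftedMatrix]

theorem shiftedMatrix_comm (H : HoffmanGraph V) (x y : H.Slim) :
    H.shiftedMatrix x y = H.shiftedMatrix y x := by
  classical
  rw [shiftedMatrix, Matrix.of_apply, Matrix.of_apply, Set.inter_comm]
  simp only [eq_comm (a := x) (b := y), H.graph.adj_comm x.1 y.1]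

theorem lt_lambdaMin_iff [Fintype V] (H : HoffmanGraph V) [Nonempty H.Slim] :
    -3 < H.lambdaMin ↔ (H.shiftedMatrix.map ((↑) : ℤ → ℝ)).PosDef := by
  classical
  have hB : H.matrixB - algebraMap ℝ _ (-3) = H.shiftedMatrix.map ((↑) : ℤ → ℝ) := by
    ext x y
    have h1 : (H.slimFatMatrix * H.slimFatMatrix.transpose) x y =
        ((H.fatNbrs x ∩ H.fatNbrs y).ncard : ℝ) := by
      have himg : H.fatNbrs x ∩ H.fatNbrs y = Subtype.val '' ((Finset.univ.filter
          fun f : H.fat => H.graph.Adj x f ∧ H.graph.Adj y f : Finset H.fat) : Set H.fat) := by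
        ext f
        constructor
        · rintro ⟨⟨hf, hx⟩, -, hy⟩
          exact ⟨⟨f, hf⟩, by simp [hx, hy], rfl⟩
        · rintro ⟨f, hf, rfl⟩
          obtain ⟨hx, hy⟩ : H.graph.Adj x f ∧ H.graph.Adj y f := by simpa using hf
          exact ⟨⟨f.2, hx⟩, f.2, hy⟩
      rw [himg, Set.ncard_image_of_injective _ Subtype.val_injective, Set.ncard_coe_finset,
        Matrix.mul_apply, ← Finset.sum_boole]
      refine Finset.sum_congr rfl fun f _ => ?_
      simp only [slimFatMatrix, Matrix.of_apply, Matrix.transpose_apply, ite_and]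
      split_ifs <;> simp
    rw [Matrix.sub_apply, matrixB, Matrix.sub_apply, h1, Matrix.algebraMap_matrix_apply,
      Matrix.map_apply, shiftedMatrix, Matrix.of_apply, slimMatrix, Matrix.of_apply]
    push_cast
    split_ifs <;> simp <;> ring
  have hherm : H.matrixB.IsHermitian := by
    refine Matrix.IsHermitian.ext fun x y => ?_
    have h1 := congrFun (congrFun hB x) y
    have h2 := congrFun (congrFun hB y) x
    rw [Matrix.sub_apply, Matrix.map_apply, Matrix.algebraMap_matrix_apply] at h1 h2
    rw [H.shiftedMatrix_comm y x] at h2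
    simp only [eq_comm (a := y)] at h2
    rw [star_trivial]
    linarith
  rw [← hB, ← hherm.lt_sInf_spectrum_iff]
  unfold lambdaMin
  convert Iff.rfl

/-- Two distinct slim vertices have at most one common fat neighbour. -/
theorem ncard_inter_le_one_of_posDef [Finite V] (H : HoffmanGraph V)
    (hpos : ∀ x y : H.Slim, x ≠ y →
      0 < H.shiftedMatrix x x + H.shiftedMatrix y y + 2 * H.shiftedMatrix x y)
    {x y : H.Slim} (hxy : x ≠ y) : (H.fatNbrs x ∩ H.fatNbrs y).ncard ≤ 1 := by
  classical
  have h := hpos x y hxy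
  rw [shiftedMatrix_self, shiftedMatrix_self, shiftedMatrix, Matrix.of_apply, if_neg hxy] at h
  have h1 := Set.ncard_le_ncard (Set.inter_subset_left (s := H.fatNbrs x) (t := H.fatNbrs y))
    (Set.toFinite _)
  have h2 := Set.ncard_le_ncard (Set.inter_subset_right (s := H.fatNbrs x) (t := H.fatNbrs y))
    (Set.toFinite _)
  split_ifs at h <;> omega

theorem specialGraph_pos_adj_iff [Finite V] (H : HoffmanGraph V) {x y : H.Slim} (hxy : x ≠ y) :
    H.specialGraph.pos.Adj x y ↔ H.shiftedMatrix x y = 1 := by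
  classical
  rw [shiftedMatrix, Matrix.of_apply, if_neg hxy]
  have h0 : (H.fatNbrs x ∩ H.fatNbrs y).ncard = 0 ↔ H.fatNbrs x ∩ H.fatNbrs y = ∅ :=
    Set.ncard_eq_zero (Set.toFinite _)
  change (x ≠ y ∧ _ ∧ _) ↔ _
  rw [← h0]
  split_ifs with h
  · exact ⟨fun h' => by omega, fun h' => ⟨hxy, h, by omega⟩⟩
  · exact ⟨fun h' => absurd h'.2.1 h, fun h' => by omega⟩

theorem specialGraph_neg_adj_iff [Finite V] (H : HoffmanGraph V) {x y : H.Slim} (hxy : x ≠ y)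
    (hc : (H.fatNbrs x ∩ H.fatNbrs y).ncard ≤ 1) :
    H.specialGraph.neg.Adj x y ↔ H.shiftedMatrix x y = -1 := by
  classical
  rw [shiftedMatrix, Matrix.of_apply, if_neg hxy]
  have h0 : (H.fatNbrs x ∩ H.fatNbrs y).ncard = 0 ↔ H.fatNbrs x ∩ H.fatNbrs y = ∅ :=
    Set.ncard_eq_zero (Set.toFinite _)
  change (x ≠ y ∧ _ ∧ _) ↔ _
  simp only [ne_eq]
  rw [← h0]
  split_ifs with h
  · exact ⟨fun h' => absurd h h'.2.1, fun h' => by omega⟩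
  · exact ⟨fun h' => by omega, fun h' => ⟨hxy, h, by omega⟩⟩

theorem underlying_adj_iff [Finite V] (H : HoffmanGraph V) {x y : H.Slim} (hxy : x ≠ y)
    (hc : (H.fatNbrs x ∩ H.fatNbrs y).ncard ≤ 1) :
    H.specialGraph.underlying.Adj x y ↔ H.shiftedMatrix x y ≠ 0 := by
  classical
  have h1 := H.specialGraph_pos_adj_iff hxy
  have h2 := H.specialGraph_neg_adj_iff hxy hc
  change H.specialGraph.pos.Adj x y ∨ H.specialGraph.neg.Adj x y ↔ _
  rw [h1, h2, shiftedMatrix, Matrix.of_apply, if_neg hxy]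
  split_ifs <;> omega

/-- If the special graph is disconnected, the vertices of one component and the remaining slim
vertices, each with their fat neighbours, form a decomposition. -/
theorem connected_underlying [Finite V] (H : HoffmanGraph V) (hind : H.IsIndecomposable)
    [Nonempty H.Slim]
    (hc : ∀ x y : H.Slim, x ≠ y → (H.fatNbrs x ∩ H.fatNbrs y).ncard ≤ 1) :
    H.specialGraph.underlying.Connected := by
  classical
  refine @SimpleGraph.Connected.mk _ _ ?_ inferInstance
  by_contra hn
  simp only [SimpleGraph.Preconnected, not_forall] at hn
  obtain ⟨a, b, hab⟩ := hn
  set R : Fin 2 → H.Slim → Prop := ![fun x => H.specialGraph.underlying.Reachable a x,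
    fun x => ¬ H.specialGraph.underlying.Reachable a x] with hR
  have hR2 : ∀ x, ∃ i, R i x := by
    intro x
    by_cases hx : H.specialGraph.underlying.Reachable a x
    · exact ⟨0, hx⟩
    · exact ⟨1, hx⟩
  have hRdisj : ∀ i j x, R i x → R j x → i = j := by
    intro i j x
    fin_cases i <;> fin_cases j <;> simp [hR]
  have hRadj : ∀ i j x y, R i x → R j y → H.specialGraph.underlying.Adj x y → i = j := by
    intro i j x y hx hy hadj
    fin_cases i <;> fin_cases j <;> simp [hR] at hx hy ⊢
    · exact hy (hx.trans hadj.reachable)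
    · exact hx (hy.trans hadj.reachable.symm)
  refine hind ⟨2, le_rfl, fun i => {z | ∃ x : H.Slim, R i x ∧ (z = x ∨ z ∈ H.fatNbrs x)}, ?_⟩
  have hslim : ∀ i (x : V) (hx : x ∉ H.fat),
      (∃ y : H.Slim, R i y ∧ (x = y ∨ x ∈ H.fatNbrs y)) → R i ⟨x, hx⟩ := by
    rintro i x hx ⟨y, hy, rfl | hxy⟩
    · exact hy
    · exact absurd hxy.1 hx
  have key : ∀ i j, i ≠ j → ∀ (x y : H.Slim), R i x → R j y → x ≠ y ∧
      ((H.fatNbrs x ∩ H.fatNbrs y).ncard = 1 ↔ H.graph.Adj x y) := by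
    intro i j hij x y hx hy
    have hxy : x ≠ y := by
      rintro rfl
      exact hij (hRdisj i j x hx hy)
    have hna := mt (hRadj i j x y hx hy) hij
    rw [H.underlying_adj_iff hxy (hc x y hxy), shiftedMatrix, Matrix.of_apply, if_neg hxy] at hna
    have := hc x y hxy
    refine ⟨hxy, ?_⟩
    split_ifs at hna with h <;> simp only [h, iff_true, iff_false] <;> omega
  refine ⟨?_, ?_, ?_, ?_, ?_, ?_, ?_⟩
  · rintro i f ⟨x, hx, rfl | hf⟩ hfat
    · exact absurd hfat x.2
    · exact ⟨x, ⟨x, hx, Or.inl rfl⟩, hf.2.symm⟩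
  · intro i
    fin_cases i
    · exact ⟨a, a, SimpleGraph.Reachable.refl a, Or.inl rfl⟩
    · exact ⟨b, b, hab, Or.inl rfl⟩
  · refine Set.eq_univ_of_forall fun z => Set.mem_iUnion.2 ?_
    by_cases hz : z ∈ H.fat
    · obtain ⟨x, hx⟩ := H.not_isolated z hz
      have hxs : x ∉ H.fat := fun hxf => H.coclique hz hxf hx.ne hx
      obtain ⟨i, hi⟩ := hR2 ⟨x, hxs⟩
      exact ⟨i, ⟨x, hxs⟩, hi, Or.inr ⟨hz, hx.symm⟩⟩
    · obtain ⟨i, hi⟩ := hR2 ⟨z, hz⟩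
      exact ⟨i, ⟨z, hz⟩, hi, Or.inl rfl⟩
  · intro i j hij x hx hxi hxj
    exact hij (hRdisj i j _ (hslim i x hx hxi) (hslim j x hx hxj))
  · intro i x hxi hx f hf
    exact ⟨⟨x, hx⟩, hslim i x hx hxi, Or.inr hf⟩
  · intro i j hij x hxi y hyj hx hy
    exact hc ⟨x, hx⟩ ⟨y, hy⟩ (key i j hij _ _ (hslim i x hx hxi) (hslim j y hy hyj)).1
  · intro i j hij x hxi y hyj hx hy
    exact (key i j hij ⟨x, hx⟩ ⟨y, hy⟩ (hslim i x hx hxi) (hslim j y hy hyj)).2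

/-! ### Induced copies of `𝔎₁,₂` -/

theorem exists_iso_K12 (H : HoffmanGraph V) (x : H.Slim) {f g : V} (hf : f ∈ H.fatNbrs x)
    (hg : g ∈ H.fatNbrs x) (hfg : f ≠ g) :
    ∃ hW : H.IsHoffmanSubset {x.1, f, g}, Nonempty ((H.induce {x.1, f, g} hW).Iso K12) := by
  have hxf : x.1 ≠ f := hf.2.ne
  have hxg : x.1 ≠ g := hg.2.ne
  have hnfg : ¬ H.graph.Adj f g := H.coclique hf.1 hg.1 hfg
  refine ⟨?_, ?_⟩
  · rintro h (rfl | rfl | rfl) hh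
    · exact absurd hh x.2
    · exact ⟨x, Or.inl rfl, hf.2.symm⟩
    · exact ⟨x, Or.inl rfl, hg.2.symm⟩
  · let φ : Fin 1 ⊕ Fin 2 → ({x.1, f, g} : Set V) :=
      Sum.elim (fun _ => ⟨x, by simp⟩) ![⟨f, by simp⟩, ⟨g, by simp⟩]
    have hφ : Function.Bijective φ := by
      constructor
      · rintro (i | i) (j | j) hij
        · exact congrArg _ (Subsingleton.elim i j)
        · fin_cases j <;> simp [φ, hxf, hxg] at hij
        · fin_cases i <;> simp [φ, hxf.symm, hxg.symm] at hij
        · fin_cases i <;> fin_cases j <;> simp [φ, hfg, hfg.symm] at hij ⊢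
      · rintro ⟨z, rfl | rfl | rfl⟩
        · exact ⟨Sum.inl 0, rfl⟩
        · exact ⟨Sum.inr 0, rfl⟩
        · exact ⟨Sum.inr 1, rfl⟩
    refine ⟨⟨(Equiv.ofBijective φ hφ).symm, ?_, ?_⟩⟩
    · intro z
      obtain ⟨i, rfl⟩ := hφ.2 z
      rw [show (Equiv.ofBijective φ hφ).symm (φ i) = i from
        (Equiv.ofBijective φ hφ).symm_apply_apply i]
      change i ∈ Set.range Sum.inr ↔ (φ i).1 ∈ H.fat
      rcases i with i | i
      · simp [φ, x.2]
      · fin_cases i <;> simp [φ, hf.1, hg.1]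
    · intro z w
      obtain ⟨i, rfl⟩ := hφ.2 z
      obtain ⟨j, rfl⟩ := hφ.2 w
      rw [show (Equiv.ofBijective φ hφ).symm (φ i) = i from
        (Equiv.ofBijective φ hφ).symm_apply_apply i,
        show (Equiv.ofBijective φ hφ).symm (φ j) = j from
        (Equiv.ofBijective φ hφ).symm_apply_apply j]
      change (completeBipartiteGraph (Fin 1) (Fin 2)).Adj i j ↔ H.graph.Adj (φ i).1 (φ j).1
      rcases i with i | i <;> rcases j with j | j
      · simp [φ]
      · fin_cases j <;> simp [φ, hf.2, hg.2]
      · fin_cases i <;> simp [φ, hf.2.symm, hg.2.symm]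
      · have hngf : ¬ H.graph.Adj g f := fun h => hnfg h.symm
        fin_cases i <;> fin_cases j <;> simp [φ, hnfg, hngf]

theorem exists_eq_of_iso_K12 (H : HoffmanGraph V) {W : Set V} {hW : H.IsHoffmanSubset W}
    (e : (H.induce W hW).Iso K12) : ∃ (x : H.Slim) (f g : V), f ∈ H.fatNbrs x ∧
      g ∈ H.fatNbrs x ∧ f ≠ g ∧ W = {x.1, f, g} := by
  have hfat : ∀ i, (e.toEquiv.symm i).1 ∈ H.fat ↔ i ∈ K12.fat := fun i => by
    have := e.fat_iff (e.toEquiv.symm i)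
    rw [Equiv.apply_symm_apply] at this
    exact this.symm
  have hadj : ∀ i j, H.graph.Adj (e.toEquiv.symm i).1 (e.toEquiv.symm j).1 ↔
      K12.graph.Adj i j := fun i j => by
    have := e.adj_iff (e.toEquiv.symm i) (e.toEquiv.symm j)
    rw [Equiv.apply_symm_apply, Equiv.apply_symm_apply] at this
    exact this.symm
  have hf : ∀ i : Fin 2, (e.toEquiv.symm (Sum.inr i)).1 ∈
      H.fatNbrs (e.toEquiv.symm (Sum.inl 0)).1 := fun i =>
    ⟨(hfat _).2 ⟨i, rfl⟩, (hadj _ _).2 (by simp [K12])⟩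
  refine ⟨⟨(e.toEquiv.symm (Sum.inl 0)).1, fun h => by simpa [K12] using (hfat _).1 h⟩,
    _, _, hf 0, hf 1, fun h => ?_, ?_⟩
  · have := e.toEquiv.symm.injective (Subtype.ext h)
    simp at this
  · ext z
    constructor
    · intro hz
      obtain ⟨i, hi⟩ := e.toEquiv.symm.surjective ⟨z, hz⟩
      have hi' : (e.toEquiv.symm i).1 = z := congrArg Subtype.val hi
      rw [← hi']
      rcases i with i | i
      · fin_cases i
        exact Or.inl rfl
      · fin_cases i
        · exact Or.inr (Or.inl rfl)
        · exact Or.inr (Or.inr rfl)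
    · rintro (rfl | rfl | rfl)
      · exact (e.toEquiv.symm (Sum.inl 0)).2
      · exact (e.toEquiv.symm (Sum.inr 0)).2
      · exact (e.toEquiv.symm (Sum.inr 1)).2

/-- `𝔎₁,₂` occurs exactly once if and only if `v` has two fat neighbours and
every other slim vertex has one. -/
theorem existsUnique_K12_iff [Finite V] (H : HoffmanGraph V) (hfat : H.IsFat) {v : H.Slim}
    (hv : 2 ≤ (H.fatNbrs v).ncard) :
    (∃! W : Set V, ∃ hW : H.IsHoffmanSubset W, Nonempty ((H.induce W hW).Iso K12)) ↔
      (H.fatNbrs v).ncard = 2 ∧ ∀ x : H.Slim, x ≠ v → (H.fatNbrs x).ncard = 1 := by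
  constructor
  · rintro ⟨W, -, hW⟩
    have hW' : ∀ (x : H.Slim) (f g : V), f ∈ H.fatNbrs x → g ∈ H.fatNbrs x → f ≠ g →
        {x.1, f, g} = W := fun x f g hf hg hfg => hW _ (H.exists_iso_K12 x hf hg hfg)
    obtain ⟨f, hf, g, hg, hfg⟩ := (Set.one_lt_ncard (Set.toFinite _)).1 hv
    have hWv := hW' v f g hf hg hfg
    refine ⟨le_antisymm ?_ hv, fun x hx => le_antisymm ?_ ?_⟩
    · have hsub : H.fatNbrs v ⊆ {f, g} := by
        intro h hh
        by_cases hhf : h = f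
        · exact Or.inl hhf
        · have h1 : h ∈ ({v.1, f, g} : Set V) := by
            rw [hWv, ← hW' v h f hh hf hhf]
            exact Or.inr (Or.inl rfl)
          rcases h1 with h1 | h1
          · exact absurd (h1 ▸ hh.1) v.2
          · exact h1
      exact (Set.ncard_le_ncard hsub (Set.toFinite _)).trans (Set.ncard_pair hfg).le
    · by_contra! hn
      obtain ⟨f', hf', g', hg', hfg'⟩ := (Set.one_lt_ncard (Set.toFinite _)).1 hn
      have h1 : x.1 ∈ ({v.1, f, g} : Set V) := by
        rw [hWv, ← hW' x f' g' hf' hg' hfg']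
        exact Or.inl rfl
      rcases h1 with h1 | h1 | h1
      · exact hx (Subtype.ext h1)
      · exact x.2 (h1 ▸ hf.1)
      · exact x.2 (h1 ▸ hg.1)
    · exact Nat.succ_le_of_lt ((Set.ncard_pos (Set.toFinite _)).2 (hfat x x.2))
  · rintro ⟨h2, h1⟩
    obtain ⟨f, g, hfg, hv2⟩ := Set.ncard_eq_two.1 h2
    have hf : f ∈ H.fatNbrs v := by rw [hv2]; simp
    have hg : g ∈ H.fatNbrs v := by rw [hv2]; simp
    refine ⟨{v.1, f, g}, H.exists_iso_K12 v hf hg hfg, ?_⟩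
    rintro W ⟨hW, ⟨e⟩⟩
    obtain ⟨x, f', g', hf', hg', hfg', rfl⟩ := H.exists_eq_of_iso_K12 e
    have hsub : ({f', g'} : Set V) ⊆ H.fatNbrs x := by
      rintro z (rfl | rfl)
      · exact hf'
      · exact hg'
    have hcard := Set.ncard_le_ncard hsub (Set.toFinite _)
    rw [Set.ncard_pair hfg'] at hcard
    have hxv : x = v := by
      by_contra hxv
      have := h1 x hxv
      omega
    subst hxv
    have := Set.eq_of_subset_of_ncard_le hsub (by rw [h2, Set.ncard_pair hfg']) (Set.toFinite _)
    rw [this, hv2]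

end HoffmanGraph

/-! ### Signed blocks -/

namespace EdgeSignedGraph

/-- The edge-signed graph is complete, and every triangle has an even number of `(-)`-edges. -/
def IsBalancedComplete {V : Type*} (T : EdgeSignedGraph V) : Prop :=
  (∀ x y, x ≠ y → T.pos.Adj x y ∨ T.neg.Adj x y) ∧
    ∀ x y z, x ≠ y → y ≠ z → x ≠ z → (T.pos.Adj x y ↔ (T.pos.Adj y z ↔ T.pos.Adj x z))

theorem Iso.isBalancedComplete {V W : Type*} {S : EdgeSignedGraph V} {T : EdgeSignedGraph W}
    (e : S.Iso T) (hT : T.IsBalancedComplete) : S.IsBalancedComplete := by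
  have hinj : ∀ x y, x ≠ y → e.toEquiv x ≠ e.toEquiv y := fun x y => e.toEquiv.injective.ne
  refine ⟨fun x y hxy => ?_, fun x y z hxy hyz hxz => ?_⟩
  · rw [← e.pos_iff, ← e.neg_iff]
    exact hT.1 _ _ (hinj x y hxy)
  · rw [← e.pos_iff, ← e.pos_iff, ← e.pos_iff]
    exact hT.2 _ _ _ (hinj x y hxy) (hinj y z hyz) (hinj x z hxz)

theorem isBalancedComplete_posComplete (n : ℕ) : (posComplete n).IsBalancedComplete := by
  refine ⟨fun x y h => Or.inl h, fun x y z hxy hyz hxz => ?_⟩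
  exact ⟨fun _ => ⟨fun _ => hxz, fun _ => hyz⟩, fun _ => hxy⟩

theorem isBalancedComplete_negK2 : negK2.IsBalancedComplete := by
  refine ⟨fun x y h => Or.inr h, fun x y z hxy hyz hxz => ?_⟩
  omega

theorem isBalancedComplete_triangleOne : triangleOne.IsBalancedComplete := by
  unfold IsBalancedComplete triangleOne
  simp only [SimpleGraph.fromEdgeSet_adj, Set.mem_insert_iff, Set.mem_singleton_iff, Sym2.eq_iff]
  exact ⟨by decide, by decide⟩

variable {V : Type*} (T : EdgeSignedGraph V) {W : Set V}

theorem nonempty_iso_posComplete [Finite V] (hW : ∀ x ∈ W, ∀ y ∈ W, x ≠ y → T.pos.Adj x y) :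
    Nonempty ((T.induce W).Iso (posComplete W.ncard)) := by
  have e : W ≃ Fin W.ncard := Finite.equivFinOfCardEq (Nat.card_coe_set_eq W)
  refine ⟨⟨e, fun x y => ?_, fun x y => ?_⟩⟩
  · refine ⟨fun h => hW x x.2 y y.2 fun hxy => ?_, fun h => e.injective.ne ?_⟩
    · exact h (congrArg e (Subtype.ext hxy))
    · exact (SimpleGraph.Adj.ne h : x ≠ y)
  · refine ⟨fun h => h.elim, fun h => ?_⟩
    have hne : x.1 ≠ y.1 := SimpleGraph.Adj.ne (G := T.neg) h
    exact (SimpleGraph.disjoint_left.1 T.disjoint _ _ (hW x x.2 y y.2 hne) h).elim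

theorem nonempty_iso_negK2 {a b : V} (hW : W = {a, b}) (hab : T.neg.Adj a b) :
    Nonempty ((T.induce W).Iso negK2) := by
  subst hW
  have hpos : ¬ T.pos.Adj a b := fun h => SimpleGraph.disjoint_left.1 T.disjoint _ _ h hab
  have hpos' : ¬ T.pos.Adj b a := fun h => hpos h.symm
  let φ : Fin 2 → ({a, b} : Set V) := ![⟨a, by simp⟩, ⟨b, by simp⟩]
  have hφ : Function.Bijective φ := by
    constructor
    · intro i j hij
      fin_cases i <;> fin_cases j <;> simp [φ, hab.ne, hab.ne'] at hij ⊢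
    · rintro ⟨z, rfl | rfl⟩
      · exact ⟨0, rfl⟩
      · exact ⟨1, rfl⟩
  have happ : ∀ i, (Equiv.ofBijective φ hφ).symm (φ i) = i :=
    (Equiv.ofBijective φ hφ).symm_apply_apply
  refine ⟨⟨(Equiv.ofBijective φ hφ).symm, fun x y => ?_, fun x y => ?_⟩⟩ <;>
    obtain ⟨i, rfl⟩ := hφ.2 x <;> obtain ⟨j, rfl⟩ := hφ.2 y <;> rw [happ, happ]
  · change negK2.pos.Adj i j ↔ T.pos.Adj (φ i).1 (φ j).1
    fin_cases i <;> fin_cases j <;> simp [φ, negK2, hpos, hpos']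
  · change negK2.neg.Adj i j ↔ T.neg.Adj (φ i).1 (φ j).1
    fin_cases i <;> fin_cases j <;> simp [φ, negK2, hab, hab.symm]

theorem exists_iso_triangleOne {v a b : V} (hW : W = {v, a, b}) (hva : T.neg.Adj v a)
    (hvb : T.neg.Adj v b) (hab : T.pos.Adj a b) (hv : v ∈ W) :
    ∃ e : (T.induce W).Iso triangleOne, e.toEquiv ⟨v, hv⟩ = 0 := by
  subst hW
  have hd := SimpleGraph.disjoint_left.1 T.disjoint
  have h1 : ¬ T.pos.Adj v a := fun h => hd _ _ h hva
  have h1' : ¬ T.pos.Adj a v := fun h => h1 h.symm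
  have h2 : ¬ T.pos.Adj v b := fun h => hd _ _ h hvb
  have h2' : ¬ T.pos.Adj b v := fun h => h2 h.symm
  have h3 : ¬ T.neg.Adj a b := hd _ _ hab
  have h3' : ¬ T.neg.Adj b a := fun h => h3 h.symm
  let φ : Fin 3 → ({v, a, b} : Set V) := ![⟨v, by simp⟩, ⟨a, by simp⟩, ⟨b, by simp⟩]
  have hφ : Function.Bijective φ := by
    constructor
    · intro i j hij
      fin_cases i <;> fin_cases j <;>
        simp [φ, hva.ne, hva.ne', hvb.ne, hvb.ne', hab.ne, hab.ne'] at hij ⊢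
    · rintro ⟨z, rfl | rfl | rfl⟩
      · exact ⟨0, rfl⟩
      · exact ⟨1, rfl⟩
      · exact ⟨2, rfl⟩
  have happ : ∀ i, (Equiv.ofBijective φ hφ).symm (φ i) = i :=
    (Equiv.ofBijective φ hφ).symm_apply_apply
  refine ⟨⟨(Equiv.ofBijective φ hφ).symm, fun x y => ?_, fun x y => ?_⟩, happ 0⟩ <;>
    obtain ⟨i, rfl⟩ := hφ.2 x <;> obtain ⟨j, rfl⟩ := hφ.2 y <;> rw [happ, happ]
  · change triangleOne.pos.Adj i j ↔ T.pos.Adj (φ i).1 (φ j).1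
    fin_cases i <;> fin_cases j <;> simp [φ, triangleOne, h1, h1', h2, h2', hab, hab.symm]
  · change triangleOne.neg.Adj i j ↔ T.neg.Adj (φ i).1 (φ j).1
    fin_cases i <;> fin_cases j <;>
      simp [φ, triangleOne, h3, h3', hva, hvb, hva.symm, hvb.symm]

end EdgeSignedGraph

/-! ### Signs of the blocks -/

namespace HoffmanGraph

variable {V : Type*} (H : HoffmanGraph V) {v : H.Slim}

/-- The only vertex that can be joined by `(-)`-edges to two other vertices of a clique
is the one with two fat neighbours: a unique fat neighbour would be shared by all three,
while the remaining edge would be a `(+)`-edge. -/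
theorem eq_of_neg_of_neg (h1 : ∀ x : H.Slim, x ≠ v → (H.fatNbrs x).ncard = 1)
    (hbal : ∀ a b c, H.specialGraph.underlying.Adj a b → H.specialGraph.underlying.Adj b c →
      H.specialGraph.underlying.Adj a c →
      (H.specialGraph.pos.Adj a b ↔ (H.specialGraph.pos.Adj b c ↔ H.specialGraph.pos.Adj a c)))
    {a b c : H.Slim} (hab : H.specialGraph.neg.Adj a b) (hac : H.specialGraph.neg.Adj a c)
    (hbc : H.specialGraph.underlying.Adj b c) : a = v := by
  by_contra hav
  have hd := SimpleGraph.disjoint_left.1 H.specialGraph.disjoint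
  have hpos : H.specialGraph.pos.Adj b c := by
    have := hbal b a c (Or.inr hab.symm) (Or.inr hac) hbc
    have h2 : ¬ H.specialGraph.pos.Adj b a := fun h => hd _ _ h hab.symm
    have h3 : ¬ H.specialGraph.pos.Adj a c := fun h => hd _ _ h hac
    tauto
  obtain ⟨f, hf⟩ := Set.ncard_eq_one.1 (h1 a hav)
  have key : ∀ x : H.Slim, H.specialGraph.neg.Adj a x → f ∈ H.fatNbrs x := by
    rintro x ⟨-, -, hne⟩
    obtain ⟨g, hg, hgx⟩ := Set.nonempty_iff_ne_empty.2 hne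
    rw [hf] at hg
    rwa [← Set.mem_singleton_iff.1 hg]
  have : f ∈ H.fatNbrs b ∩ H.fatNbrs c := ⟨key b hab, key c hac⟩
  rw [hpos.2.2] at this
  exact this

/-- A triangle with a `(-)`-edge has exactly two of them, and their common vertex would be `v`. -/
theorem pos_or_eq_pair_of_isClique (h1 : ∀ x : H.Slim, x ≠ v → (H.fatNbrs x).ncard = 1)
    (hbal : ∀ a b c, H.specialGraph.underlying.Adj a b → H.specialGraph.underlying.Adj b c →
      H.specialGraph.underlying.Adj a c →
      (H.specialGraph.pos.Adj a b ↔ (H.specialGraph.pos.Adj b c ↔ H.specialGraph.pos.Adj a c)))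
    {W : Set H.Slim} (hW : H.specialGraph.underlying.IsClique W) (hv : v ∉ W) :
    (∀ x ∈ W, ∀ y ∈ W, x ≠ y → H.specialGraph.pos.Adj x y) ∨
      ∃ a b, W = {a, b} ∧ H.specialGraph.neg.Adj a b := by
  by_cases hall : ∀ x ∈ W, ∀ y ∈ W, x ≠ y → H.specialGraph.pos.Adj x y
  · exact Or.inl hall
  right
  push Not at hall
  obtain ⟨a, ha, b, hb, hab, hn⟩ := hall
  have hneg : H.specialGraph.neg.Adj a b := (hW ha hb hab).resolve_left hn
  refine ⟨a, b, Set.Subset.antisymm (fun c hc => ?_) ?_, hneg⟩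
  · by_contra hcab
    have hca : a ≠ c := fun h => hcab (Or.inl h.symm)
    have hcb : b ≠ c := fun h => hcab (Or.inr h.symm)
    rcases hW ha hc hca with hac | hac
    · rcases hW hb hc hcb with hbc | hbc
      · exact hn ((hbal a b c (hW ha hb hab) (hW hb hc hcb) (hW ha hc hca)).2
          (iff_of_true hbc hac))
      · exact hv (H.eq_of_neg_of_neg h1 hbal hneg.symm hbc (hW ha hc hca) ▸ hb)
    · exact hv (H.eq_of_neg_of_neg h1 hbal hneg hac (hW hb hc hcb) ▸ ha)
  · rintro c (rfl | rfl)
    · exact ha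
    · exact hb

variable [Finite V]

/-- In a clique with a `(-)`-edge and at least three vertices, `v` is joined by `(-)`-edges to all
other vertices, and these have pairwise distinct fat neighbours, all of them shared with `v`. -/
theorem pos_or_eq_pair_or_eq_triple_of_isClique (h2 : (H.fatNbrs v).ncard = 2)
    (h1 : ∀ x : H.Slim, x ≠ v → (H.fatNbrs x).ncard = 1)
    (hbal : ∀ a b c, H.specialGraph.underlying.Adj a b → H.specialGraph.underlying.Adj b c →
      H.specialGraph.underlying.Adj a c →
      (H.specialGraph.pos.Adj a b ↔ (H.specialGraph.pos.Adj b c ↔ H.specialGraph.pos.Adj a c)))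
    {W : Set H.Slim} (hW : H.specialGraph.underlying.IsClique W) (hv : v ∈ W) :
    (∀ x ∈ W, ∀ y ∈ W, x ≠ y → H.specialGraph.pos.Adj x y) ∨
      (∃ a b, W = {a, b} ∧ H.specialGraph.neg.Adj a b) ∨
      ∃ a b, W = {v, a, b} ∧ H.specialGraph.neg.Adj v a ∧ H.specialGraph.neg.Adj v b ∧
        H.specialGraph.pos.Adj a b := by
  have key : ∀ b ∈ W, ∀ c ∈ W, c ≠ v → b ≠ c → H.specialGraph.neg.Adj v b →
      H.specialGraph.neg.Adj v c ∧ H.specialGraph.pos.Adj b c := by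
    intro b hb c hc hcv hbc hvb
    have hnvb : ¬ H.specialGraph.pos.Adj v b := fun h =>
      SimpleGraph.disjoint_left.1 H.specialGraph.disjoint _ _ h hvb
    have hiff := hbal v b c (Or.inr hvb) (hW hb hc hbc) (hW hv hc hcv.symm)
    have hpos : H.specialGraph.pos.Adj b c := by
      refine (hW hb hc hbc).resolve_right fun hneg => hvb.ne ?_
      exact (H.eq_of_neg_of_neg h1 hbal hvb.symm hneg (hW hv hc hcv.symm)).symm
    refine ⟨(hW hv hc hcv.symm).resolve_left fun h => hnvb (hiff.2 (iff_of_true hpos h)), hpos⟩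
  by_cases hvneg : ∃ b ∈ W, H.specialGraph.neg.Adj v b
  · right
    obtain ⟨b, hb, hvb⟩ := hvneg
    by_cases hWvb : W ⊆ {v, b}
    · refine Or.inl ⟨v, b, Set.Subset.antisymm hWvb ?_, hvb⟩
      rintro c (rfl | rfl)
      · exact hv
      · exact hb
    obtain ⟨c, hc, hcvb⟩ := Set.not_subset.1 hWvb
    have hcv : c ≠ v := fun h => hcvb (Or.inl h)
    have hbc : b ≠ c := fun h => hcvb (Or.inr h.symm)
    obtain ⟨hvc, hpbc⟩ := key b hb c hc hcv hbc hvb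
    refine Or.inr ⟨b, c, Set.Subset.antisymm (fun x hx => ?_) ?_, hvb, hvc, hpbc⟩
    · by_contra hxn
      have hxv : x ≠ v := fun h => hxn (Or.inl h)
      have hbx : b ≠ x := fun h => hxn (Or.inr (Or.inl h.symm))
      have hcx : c ≠ x := fun h => hxn (Or.inr (Or.inr h.symm))
      obtain ⟨hvx, hpbx⟩ := key b hb x hx hxv hbx hvb
      obtain ⟨-, hpcx⟩ := key c hc x hx hxv hcx hvc
      -- `b`, `c`, `x` share pairwise different fat neighbours with `v`.
      obtain ⟨f, hf, hfb⟩ := Set.nonempty_iff_ne_empty.2 hvb.2.2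
      obtain ⟨g, hg, hgc⟩ := Set.nonempty_iff_ne_empty.2 hvc.2.2
      obtain ⟨k, hk, hkx⟩ := Set.nonempty_iff_ne_empty.2 hvx.2.2
      have hdisj : ∀ {y z : H.Slim} {f g : V}, H.specialGraph.pos.Adj y z → f ∈ H.fatNbrs y →
          g ∈ H.fatNbrs z → f ≠ g := by
        rintro y z f g hyz hf hg rfl
        have : f ∈ H.fatNbrs y ∩ H.fatNbrs z := ⟨hf, hg⟩
        rw [hyz.2.2] at this
        exact this
      have h3 : 2 < (H.fatNbrs v).ncard := (Set.two_lt_ncard_iff (Set.toFinite _)).2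
        ⟨f, g, k, hf, hg, hk, hdisj hpbc hfb hgc, hdisj hpbx hfb hkx, hdisj hpcx hgc hkx⟩
      omega
    · rintro x (rfl | rfl | rfl)
      · exact hv
      · exact hb
      · exact hc
  · left
    have hvpos : ∀ b ∈ W, v ≠ b → H.specialGraph.pos.Adj v b := fun b hb hvb =>
      (hW hv hb hvb).resolve_right fun h => hvneg ⟨b, hb, h⟩
    intro x hx y hy hxy
    by_cases hxv : x = v
    · subst hxv; exact hvpos y hy hxy
    by_cases hyv : y = v
    · subst hyv; exact (hvpos x hx (Ne.symm hxy)).symm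
    exact (hbal x y v (hW hx hy hxy) (hW hy hv hyv) (hW hx hv hxv)).2
      (iff_of_true (hvpos y hy (Ne.symm hyv)).symm (hvpos x hx (Ne.symm hxv)).symm)

/-! ### The characterization -/

theorem ncard_inter_le_one (h1 : ∀ x : H.Slim, x ≠ v → (H.fatNbrs x).ncard = 1) {x y : H.Slim}
    (hxy : x ≠ y) : (H.fatNbrs x ∩ H.fatNbrs y).ncard ≤ 1 := by
  by_cases hx : x = v
  · rw [← h1 y (fun h => hxy (hx.trans h.symm))]
    exact Set.ncard_le_ncard Set.inter_subset_right (Set.toFinite _)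
  · rw [← h1 x hx]
    exact Set.ncard_le_ncard Set.inter_subset_left (Set.toFinite _)

/-- Positive definiteness yields the rooted tree. -/
theorem exists_isRootedTree [DecidableEq H.Slim] (hfat : H.IsFat) (hind : H.IsIndecomposable)
    (hv : 2 ≤ (H.fatNbrs v).ncard) (B : LinearMap.BilinForm ℤ (H.Slim → ℤ))
    (hsymm : ∀ f g, B f g = B g f) (hpos : ∀ f, f ≠ 0 → 0 < B f f)
    (hB : ∀ a b, B (Pi.single a 1) (Pi.single b 1) = H.shiftedMatrix a b) :
    ∃ (p : H.Slim → H.Slim) (d : H.Slim → ℕ) (s : H.Slim → ℤ), IsRootedTree v p d ∧ s v = 0 ∧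
      (∀ a, a ≠ v → s a * s a = 1) ∧ (∀ a b, H.shiftedMatrix a b = treeGram p s a b) ∧
      (H.fatNbrs v).ncard = 2 ∧ ∀ x : H.Slim, x ≠ v → (H.fatNbrs x).ncard = 1 := by
  have : Nonempty H.Slim := ⟨v⟩
  have hindep : LinearIndependent ℤ fun a : H.Slim => (Pi.single a 1 : H.Slim → ℤ) :=
    Pi.linearIndependent_single_one H.Slim ℤ
  have hc : ∀ x y : H.Slim, x ≠ y → (H.fatNbrs x ∩ H.fatNbrs y).ncard ≤ 1 := by
    refine fun x y hxy => H.ncard_inter_le_one_of_posDef (fun x y hxy => ?_) hxy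
    have hne : (Pi.single x 1 + Pi.single y 1 : H.Slim → ℤ) ≠ 0 := by
      intro h
      have := congrFun h x
      simp [hxy] at this
    have := hpos _ hne
    simp only [map_add, LinearMap.add_apply, hB] at this
    rw [H.shiftedMatrix_comm y x] at this
    linarith
  have hconn := H.connected_underlying hind hc
  have hpos1 : ∀ a, 0 < H.shiftedMatrix a a := fun a => by
    rw [← hB]
    exact hpos _ (hindep.ne_zero a)
  have hv2 : (H.fatNbrs v).ncard = 2 := by
    have := hpos1 v
    rw [shiftedMatrix_self] at this
    omega
  have hk : ∀ x : H.Slim, 1 ≤ (H.fatNbrs x).ncard := fun x =>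
    Nat.succ_le_of_lt ((Set.ncard_pos (Set.toFinite _)).2 (hfat x x.2))
  obtain ⟨p, d, s, ht, hs, hs1, hgram⟩ := exists_isRootedTree_of_posDef B hsymm hpos
    (fun a : H.Slim => (Pi.single a 1 : H.Slim → ℤ)) hindep v
    (by rw [hB, shiftedMatrix_self, hv2]; norm_num)
    (fun a => by rw [hB, shiftedMatrix_self]; have := hk a; omega)
    (by
      rintro A hvA ⟨a, ha⟩
      by_contra! hn
      refine ha ((hconn.preconnected v a).of_forall_adj (P := (· ∈ A)) ?_ hvA)
      intro x y hxy hx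
      by_contra hy
      have := hn y hy x hx
      rw [hB, shiftedMatrix_comm] at this
      exact (H.underlying_adj_iff hxy.ne (hc x y hxy.ne)).1 hxy this)
  simp only [hB] at hgram
  refine ⟨p, d, s, ht, hs, hs1, hgram, hv2, fun x hx => ?_⟩
  have := ht.treeGram_self hs hs1 x
  rw [← hgram, shiftedMatrix_self, if_neg hx] at this
  omega

theorem underlying_eq_familyGraph [DecidableEq H.Slim] {p : H.Slim → H.Slim} {d : H.Slim → ℕ}
    {s : H.Slim → ℤ}
    (h1 : ∀ x : H.Slim, x ≠ v → (H.fatNbrs x).ncard = 1) (ht : IsRootedTree v p d) (hs : s v = 0)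
    (hs1 : ∀ a, a ≠ v → s a * s a = 1) (hgram : ∀ a b, H.shiftedMatrix a b = treeGram p s a b) :
    H.specialGraph.underlying = familyGraph p := by
  ext x y
  by_cases hxy : x = y
  · subst hxy; simp
  · rw [H.underlying_adj_iff hxy (H.ncard_inter_le_one h1 hxy), hgram,
      ht.familyGraph_adj_iff_treeGram_ne_zero hs hs1 hxy]

theorem shiftedMatrix_eq_one_or_neg_one (h1 : ∀ x : H.Slim, x ≠ v → (H.fatNbrs x).ncard = 1) {x y : H.Slim}
    (hxy : H.specialGraph.underlying.Adj x y) : H.specialGraph.pos.Adj x y ∧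
      H.shiftedMatrix x y = 1 ∨ ¬ H.specialGraph.pos.Adj x y ∧ H.shiftedMatrix x y = -1 := by
  have hp := H.specialGraph_pos_adj_iff hxy.ne
  have hn := H.specialGraph_neg_adj_iff hxy.ne (H.ncard_inter_le_one h1 hxy.ne)
  rcases hxy with h | h
  · exact Or.inl ⟨h, hp.1 h⟩
  · exact Or.inr ⟨fun h' => SimpleGraph.disjoint_left.1 H.specialGraph.disjoint _ _ h' h, hn.1 h⟩

/-- A triangle has positive sign if and only if it has an even number of `(-)`-edges. -/
theorem shiftedMatrix_triangle_iff (h1 : ∀ x : H.Slim, x ≠ v → (H.fatNbrs x).ncard = 1)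
    {a b c : H.Slim} (hab : H.specialGraph.underlying.Adj a b)
    (hbc : H.specialGraph.underlying.Adj b c) (hac : H.specialGraph.underlying.Adj a c) :
    H.shiftedMatrix a b * H.shiftedMatrix b c * H.shiftedMatrix a c = 1 ↔
      (H.specialGraph.pos.Adj a b ↔ (H.specialGraph.pos.Adj b c ↔ H.specialGraph.pos.Adj a c)) := by
  rcases H.shiftedMatrix_eq_one_or_neg_one h1 hab with ⟨p1, e1⟩ | ⟨p1, e1⟩ <;>
    rcases H.shiftedMatrix_eq_one_or_neg_one h1 hbc with ⟨p2, e2⟩ | ⟨p2, e2⟩ <;>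
      rcases H.shiftedMatrix_eq_one_or_neg_one h1 hac with ⟨p3, e3⟩ | ⟨p3, e3⟩ <;>
        simp [p1, p2, p3, e1, e2, e3]

/-- If all triangles have positive sign, `B + 3I` is the Gram matrix of the rooted tree, with
the signs of the edges from the vertices to their parents. -/
theorem shiftedMatrix_eq_treeGram [DecidableEq H.Slim] {p : H.Slim → H.Slim} {d : H.Slim → ℕ}
    (h2 : (H.fatNbrs v).ncard = 2) (h1 : ∀ x : H.Slim, x ≠ v → (H.fatNbrs x).ncard = 1)
    (ht : IsRootedTree v p d) (hU : H.specialGraph.underlying = familyGraph p)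
    (htri : ∀ a b c, H.specialGraph.underlying.Adj a b → H.specialGraph.underlying.Adj b c →
      H.specialGraph.underlying.Adj a c →
      H.shiftedMatrix a b * H.shiftedMatrix b c * H.shiftedMatrix a c = 1) (a b : H.Slim) :
    H.shiftedMatrix a b =
      treeGram p (fun x => if x = v then 0 else H.shiftedMatrix x (p x)) a b := by
  set s : H.Slim → ℤ := fun x => if x = v then 0 else H.shiftedMatrix x (p x) with hs
  have hsv : s v = 0 := if_pos rfl
  have hsne : ∀ x, x ≠ v → s x = H.shiftedMatrix x (p x) := fun x hx => if_neg hx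
  have hadj : ∀ x, x ≠ v → H.specialGraph.underlying.Adj x (p x) := fun x hx => by
    rw [hU]
    exact ⟨(ht.parent_ne hx).symm, Or.inl rfl⟩
  have hs1 : ∀ x, x ≠ v → s x * s x = 1 := by
    intro x hx
    rw [hsne x hx]
    rcases H.shiftedMatrix_eq_one_or_neg_one h1 (hadj x hx) with ⟨-, e⟩ | ⟨-, e⟩ <;> rw [e] <;> rfl
  by_cases hab : a = b
  · subst hab
    rw [ht.treeGram_self hsv hs1, shiftedMatrix_self]
    split_ifs with ha
    · rw [ha, h2]; rfl
    · rw [h1 a ha]; rfl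
  by_cases hadjab : H.specialGraph.underlying.Adj a b
  · have hpar : ∀ a b : H.Slim, a ≠ b → p a = b → H.shiftedMatrix a b = treeGram p s a b := by
      rintro a b hab rfl
      have hav := ht.ne_root_of_parent_ne (Ne.symm hab)
      rw [IsRootedTree.treeGram_comm, ht.treeGram_parent hsv hav, hsne a hav]
    have hpar' : ∀ a b : H.Slim, a ≠ b → p b = a → H.shiftedMatrix a b = treeGram p s a b := by
      intro a b hab hpb
      rw [shiftedMatrix_comm, IsRootedTree.treeGram_comm, hpar b a hab.symm hpb]
    have hadj' := hadjab
    rw [hU] at hadj'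
    rcases hadj'.2 with h | h | h
    · exact hpar a b hab h
    · exact hpar' a b hab h
    · by_cases ha : a = v
      · exact hpar' a b hab (by rw [← h, ha, ht.parent_root])
      by_cases hb : b = v
      · exact hpar a b hab (by rw [h, hb, ht.parent_root])
      have hane := (ht.parent_ne ha).symm
      have hbne : b ≠ p a := by rw [h]; exact (ht.parent_ne hb).symm
      rw [ht.treeGram_of_mem_treeStar hsv (y := p a) (Or.inr rfl) (Or.inr h.symm) hab,
        if_neg hane, if_neg hbne]
      have h3 := htri a b (p a) hadjab (h ▸ hadj b hb) (hadj a ha)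
      have ha1 := hs1 a ha
      have hb1 := hs1 b hb
      have hsb : s b = H.shiftedMatrix b (p a) := by rw [hsne b hb, h]
      rw [← hsb, ← hsne a ha] at h3
      linear_combination (s a * s b) * h3 - H.shiftedMatrix a b * (s b * s b) * ha1 -
        H.shiftedMatrix a b * hb1
  · have h3 := mt (H.underlying_adj_iff hab (H.ncard_inter_le_one h1 hab)).2 hadjab
    rw [hU] at hadjab
    have h4 := mt (ht.familyGraph_adj_iff_treeGram_ne_zero hsv hs1 hab).2 hadjab
    rw [not_not] at h3 h4
    rw [h3, h4]

end HoffmanGraph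

namespace HoffmanGraph

/-- If all blocks are complete with balanced triangles, the rooted tree of the special graph makes
`B + 3I` a Gram matrix of linearly independent vectors. -/
theorem posDef_shiftedMatrix_of_blocks {V : Type*} [Fintype V] (H : HoffmanGraph V)
    (hind : H.IsIndecomposable) {v : H.Slim} (h2 : (H.fatNbrs v).ncard = 2)
    (h1 : ∀ x : H.Slim, x ≠ v → (H.fatNbrs x).ncard = 1)
    (hclaw : H.specialGraph.underlying.IsClawFree)
    (hcut : ¬ H.specialGraph.underlying.IsCutVertex v)
    (hblock : ∀ B : H.specialGraph.underlying.Subgraph, H.specialGraph.underlying.IsBlock B →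
      (H.specialGraph.induce B.verts).IsBalancedComplete) :
    (H.shiftedMatrix.map ((↑) : ℤ → ℝ)).PosDef := by
  classical
  have : Nonempty H.Slim := ⟨v⟩
  have hconn := H.connected_underlying hind fun x y hxy => H.ncard_inter_le_one h1 hxy
  have hclique : ∀ W, H.specialGraph.underlying.IsTwoConnectedOn W →
      H.specialGraph.underlying.IsClique W := by
    intro W hW x hx y hy hxy
    obtain ⟨B, hB, hWB⟩ := hW.exists_isBlock
    exact (hblock B hB).1 ⟨x, hWB hx⟩ ⟨y, hWB hy⟩ fun h => hxy (congrArg Subtype.val h)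
  obtain ⟨p, d, ht, hU⟩ := SimpleGraph.exists_eq_familyGraph hconn hclaw hclique hcut
  have htri : ∀ a b c, H.specialGraph.underlying.Adj a b → H.specialGraph.underlying.Adj b c →
      H.specialGraph.underlying.Adj a c →
      H.shiftedMatrix a b * H.shiftedMatrix b c * H.shiftedMatrix a c = 1 := by
    intro a b c hab hbc hac
    have hW : H.specialGraph.underlying.IsClique {a, b, c} := by
      rw [SimpleGraph.isClique_insert, SimpleGraph.isClique_pair]
      refine ⟨fun _ => hbc, ?_⟩
      rintro x (rfl | rfl) _
      · exact hab
      · exact hac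
    obtain ⟨B, hB, hWB⟩ := (hW.isTwoConnectedOn ⟨a, by simp⟩).exists_isBlock
    rw [H.shiftedMatrix_triangle_iff h1 hab hbc hac]
    exact (hblock B hB).2 ⟨a, hWB (by simp)⟩ ⟨b, hWB (by simp)⟩ ⟨c, hWB (by simp)⟩
      (fun h => hab.ne (congrArg Subtype.val h)) (fun h => hbc.ne (congrArg Subtype.val h))
      (fun h => hac.ne (congrArg Subtype.val h))
  have hM : H.shiftedMatrix.map ((↑) : ℤ → ℝ) = Matrix.of fun a b => ((treeGram p
      (fun x => if x = v then 0 else H.shiftedMatrix x (p x)) a b : ℤ) : ℝ) := by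
    ext a b
    rw [Matrix.map_apply, H.shiftedMatrix_eq_treeGram h2 h1 ht hU htri, Matrix.of_apply]
  rw [hM]
  exact ht.posDef_treeGram (if_pos rfl)

end HoffmanGraph

theorem theorem4p3 {V : Type*} [Fintype V] (H : HoffmanGraph V)
    (hfat : H.IsFat) (hind : H.IsIndecomposable)
    (v : H.Slim) (hv : 2 ≤ (H.fatNbrs v).ncard) :
    -3 < H.lambdaMin ↔
      -- (i)
      (H.specialGraph.underlying.IsClawFree ∧ H.specialGraph.underlying.IsBlockGraph) ∧
      -- (ii)
      (∃! W : Set V, ∃ hW : H.IsHoffmanSubset W,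
        Nonempty ((H.induce W hW).Iso HoffmanGraph.K12)) ∧
      -- (iii)
      ¬ H.specialGraph.underlying.IsCutVertex v ∧
      -- (iv) and (v), where `B` is the block containing `v`
      ∃ B : H.specialGraph.underlying.Subgraph,
        H.specialGraph.underlying.IsBlock B ∧
        ∃ hB : v ∈ B.verts,
          ((∃ n : ℕ, 1 ≤ n ∧ Nonempty ((H.specialGraph.induce B.verts).Iso
              (EdgeSignedGraph.posComplete n))) ∨
            Nonempty ((H.specialGraph.induce B.verts).Iso EdgeSignedGraph.negK2) ∨
            ∃ e : (H.specialGraph.induce B.verts).Iso EdgeSignedGraph.triangleOne,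
              e.toEquiv ⟨v, hB⟩ = 0) ∧
          ∀ B' : H.specialGraph.underlying.Subgraph,
            H.specialGraph.underlying.IsBlock B' → B' ≠ B →
              (∃ n : ℕ, 2 ≤ n ∧ Nonempty ((H.specialGraph.induce B'.verts).Iso
                (EdgeSignedGraph.posComplete n))) ∨
              Nonempty ((H.specialGraph.induce B'.verts).Iso EdgeSignedGraph.negK2) := by
  classical
  have : Nonempty H.Slim := ⟨v⟩
  rw [H.lt_lambdaMin_iff]
  constructor
  · intro hpd
    have hsymmZ : H.shiftedMatrix.transpose = H.shiftedMatrix := by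
      ext x y
      exact H.shiftedMatrix_comm y x
    obtain ⟨p, d, s, ht, hs, hs1, hgram, h2, h1⟩ := H.exists_isRootedTree hfat hind hv
      (Matrix.toBilin' H.shiftedMatrix) (fun f g => by
        rw [Matrix.toBilin'_apply', Matrix.toBilin'_apply', Matrix.dotProduct_mulVec,
          ← Matrix.mulVec_transpose, hsymmZ, dotProduct_comm])
      (fun f hf => hpd.toBilin'_pos_of_int hf) (fun a b => Matrix.toBilin'_single _ a b)
    have hU := H.underlying_eq_familyGraph h1 ht hs hs1 hgram
    have hconn := H.connected_underlying hind fun x y hxy => H.ncard_inter_le_one h1 hxy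
    have hbal : ∀ a b c, H.specialGraph.underlying.Adj a b → H.specialGraph.underlying.Adj b c →
        H.specialGraph.underlying.Adj a c → (H.specialGraph.pos.Adj a b ↔
          (H.specialGraph.pos.Adj b c ↔ H.specialGraph.pos.Adj a c)) := by
      intro a b c hab hbc hac
      rw [← H.shiftedMatrix_triangle_iff h1 hab hbc hac, hgram, hgram, hgram]
      rw [hU] at hab hbc hac
      exact ht.treeGram_triangle hs hs1 hab hbc hac
    have hclique : ∀ y, H.specialGraph.underlying.IsClique (treeStar p y) := by
      rw [hU]
      exact isClique_treeStar p
    have hmaxv : Maximal H.specialGraph.underlying.IsTwoConnectedOn (treeStar p v) := by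
      rw [hU]
      exact ht.maximal_treeStar_root
    have hmaxU : ∀ W, Maximal H.specialGraph.underlying.IsTwoConnectedOn W →
        Maximal (familyGraph p).IsTwoConnectedOn W := by
      rw [hU]
      exact fun _ => id
    have hvmem : v ∈ treeStar p v := Or.inl rfl
    refine ⟨⟨by rw [hU]; exact IsRootedTree.isClawFree_familyGraph p,
      by rw [hU]; exact ht.isBlockGraph_familyGraph⟩,
      (H.existsUnique_K12_iff hfat hv).2 ⟨h2, h1⟩, ?_,
      (⊤ : H.specialGraph.underlying.Subgraph).induce (treeStar p v),
      (SimpleGraph.isBlock_induce_iff _).2 hmaxv, hvmem, ?_, ?_⟩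
    · rw [hU] at hconn ⊢
      exact ht.not_isCutVertex_root hconn
    · rcases H.pos_or_eq_pair_or_eq_triple_of_isClique h2 h1 hbal (hclique v) hvmem with
        h | ⟨a, b, hW, hab⟩ | ⟨a, b, hW, hva, hvb, hab⟩
      · exact Or.inl ⟨_, (Set.ncard_pos (Set.toFinite _)).2 ⟨v, hvmem⟩,
          H.specialGraph.nonempty_iso_posComplete h⟩
      · exact Or.inr (Or.inl (H.specialGraph.nonempty_iso_negK2 hW hab))
      · exact Or.inr (Or.inr (H.specialGraph.exists_iso_triangleOne hW hva hvb hab hvmem))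
    · intro B' hB' hne
      obtain ⟨hind', hmax⟩ := (SimpleGraph.isBlock_iff B').1 hB'
      have hmax' := hmaxU _ hmax
      obtain ⟨y, hy⟩ := ht.exists_eq_treeStar hmax'
      have hyv : y ≠ v := by
        rintro rfl
        rw [hy] at hind'
        exact hne hind'
      rw [hy] at hmax'
      obtain ⟨a, hay, hpa⟩ := ht.exists_child_of_maximal hyv hmax'
      have hvn : v ∉ B'.verts := by
        rw [hy]
        intro hvy
        exact ht.ne_root_of_mem_treeStar hvy (Ne.symm hyv) rfl
      rcases H.pos_or_eq_pair_of_isClique h1 hbal (hy ▸ hclique y) hvn with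
        h | ⟨b, c, hW, hbc⟩
      · refine Or.inl ⟨_, ?_, H.specialGraph.nonempty_iso_posComplete h⟩
        refine (Set.one_lt_ncard (Set.toFinite _)).2 ⟨a, ?_, y, ?_, hay⟩
        · rw [hy]; exact Or.inr hpa
        · rw [hy]; exact Or.inl rfl
      · exact Or.inr (H.specialGraph.nonempty_iso_negK2 hW hbc)
  · rintro ⟨⟨hclaw, -⟩, hK, hcut, B, -, hB, hBv, hother⟩
    obtain ⟨h2, h1⟩ := (H.existsUnique_K12_iff hfat hv).1 hK
    refine H.posDef_shiftedMatrix_of_blocks hind h2 h1 hclaw hcut fun B' hB' => ?_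
    by_cases hBB : B' = B
    · rw [hBB]
      rcases hBv with ⟨n, -, ⟨e⟩⟩ | ⟨⟨e⟩⟩ | ⟨e, -⟩
      · exact e.isBalancedComplete (EdgeSignedGraph.isBalancedComplete_posComplete n)
      · exact e.isBalancedComplete EdgeSignedGraph.isBalancedComplete_negK2
      · exact e.isBalancedComplete EdgeSignedGraph.isBalancedComplete_triangleOne
    · rcases hother B' hB' hBB with ⟨n, -, ⟨e⟩⟩ | ⟨⟨e⟩⟩
      · exact e.isBalancedComplete (EdgeSignedGraph.isBalancedComplete_posComplete n)
      · exact e.isBalancedComplete EdgeSignedGraph.isBalancedComplete_negK2
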